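/- Let $p$ be a prime, $k$ a perfect field of characteristic $p$ and $n\ge 0$ an integer. For a ring $R$ let $W(R)$ be the ring of $p$-typical Witt vectors. Let $\mathcal{G}rass_p$ be the $p$-adic affine Grassmannian for $SL_n$, i.e. the fpqc-sheafification of the functor $$R\longmapsto SL_n(W(R)[1/p])/SL_n(W(R))$$ (left cosets of the image of $SL_n(W(R))$) on the category of $k$-algebras. For a perfect $k$-algebra $R$, a special lattice over $W(R)$ is a finitely generated projective $W(R)$-submodule $L\subset W(R)[1/p]^n$ such that the natural map $L\otimes_{W(R)}W(R)[1/p]\to W(R)[1/p]^n$ is an isomorphism and such that $\wedge^n L=W(R)$ inside $\wedge^n\big(W(R)[1/p]^n\big)=W(R)[1/p]$. Let $sp\mathcal{L}at_n(R)$ be the set of special lattices over $W(R)$; it is a functor of $R$ by sending $L$, for $R\to S$, to $L\otimes_{W(R)}W(S)\subset W(S)[1/p]^n$. Then $sp\mathcal{L}at_n$ is an fpqc-sheaf on the category of perfect $k$-algebras, and it is equal to the restriction of $\mathcal{G}rass_p$ to perfect $k$-algebras. More precisely, there is an isomorphism of functors $\mathcal{G}rass_p|_{\mathrm{perfect}}\cong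 sp\mathcal{L}at_n$ which, for every perfect $k$-algebra $R$, sends the class of $g\in SL_n(W(R)[1/p])$ to $g\cdot W(R)^n$. In particular the set $\mathcal{G}rass_p(R)$ is identified with the set of lattices $L\subset W(R)[1/p]^n$ with $\wedge^nL=W(R)$, for every perfect $k$-algebra $R$. -/

import Mathlib

open CategoryTheory TensorProduct

universe u

noncomputable section

namespace PadicGrass

/-! ### Lattices over a ring `A` in `K ^ n`, where `K` is an `A`-algebra -/

section Lattice

variable (A K : Type*) [CommRing A] [CommRing K] [Algebra A K] (n : ℕ)

/-- The determinant `(K ^ n) ^ n → K`, regarded as an `A`-multilinear alternating map. -/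
def detAlternating : (Fin n → K) [⋀^Fin n]→ₗ[A] K :=
  { (Matrix.detRowAlternating (n := Fin n) (R := K)).toMultilinearMap.restrictScalars A with
    map_eq_zero_of_eq' := fun v _ _ h hij =>
      (Matrix.detRowAlternating (n := Fin n) (R := K)).map_eq_zero_of_eq v h hij }

variable {A K n}

/-- The canonical map `⋀ⁿ L → ⋀ⁿ (K ^ n) = K`, `v₁ ∧ ⋯ ∧ vₙ ↦ det (v₁, …, vₙ)`. -/
def wedgeMap (L : Submodule A (Fin n → K)) : ⋀[A]^n L →ₗ[A] K :=
  exteriorPower.alternatingMapLinearEquiv ((detAlternating A K n).compLinearMap L.subtype)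

/-- `L ⊆ K ^ n` is a lattice: it is a finitely generated projective `A`-submodule, and the natural
map `K ⊗[A] L → K ^ n` is bijective. -/
structure IsLattice (L : Submodule A (Fin n → K)) : Prop where
  fg : L.FG
  projective : Module.Projective A L
  isBaseChange : IsBaseChange K L.subtype

/-- `L` is a special lattice: a lattice with `⋀ⁿ L = A` as `A`-submodules of `⋀ⁿ (K ^ n) = K`
(here `1 : Submodule A K` is the image of `A` in `K`). -/
structure IsSpecialLattice (L : Submodule A (Fin n → K)) : Prop extends IsLattice L where
  wedge : LinearMap.range (wedgeMap L) = (1 : Submodule A K)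

variable (A K n) in
/-- The standard lattice: the image of `A ^ n` in `K ^ n`. -/
def standardLattice : Submodule A (Fin n → K) :=
  LinearMap.range ((Algebra.linearMap A K).compLeft (Fin n))

/-- The submodule `g • L` for a matrix `g` over `K`. -/
def matrixSMul (g : Matrix (Fin n) (Fin n) K) (L : Submodule A (Fin n → K)) :
    Submodule A (Fin n → K) :=
  L.map (g.mulVecLin.restrictScalars A)

/-- For a ring homomorphism `φ : K → K'` and an `A`-submodule `L` of `K ^ n`, the `B`-submodule
of `K' ^ n` generated by `φ(L)`; it is the image of the natural map `B ⊗[A] L → K' ^ n`. -/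
def extendLattice (B : Type*) {K' : Type*} [CommRing B] [CommRing K'] [Algebra B K'] (φ : K →+* K')
    (L : Submodule A (Fin n → K)) : Submodule B (Fin n → K') :=
  Submodule.span B ((fun v : Fin n → K => fun i => φ (v i)) '' (L : Set (Fin n → K)))

theorem wedgeMap_range (L : Submodule A (Fin n → K)) (s : Set (Fin n → K))
    (hs : Submodule.span A s = L) :
    LinearMap.range (wedgeMap L) =
      Submodule.span A {d | ∃ v : Fin n → (Fin n → K), (∀ i, v i ∈ s) ∧ d = Matrix.det v} := by
  have hsL : s ⊆ L := hs ▸ Submodule.subset_span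
  have h1 : Submodule.span A ((Subtype.val : L → _) ⁻¹' s) = ⊤ := by
    subst hs
    exact Submodule.span_span_coe_preimage
  have h2 := exteriorPower.ιMulti_span_of_span A n L h1
  rw [LinearMap.range_eq_map, ← h2, Submodule.map_span]
  congr 1
  ext d
  constructor
  · rintro ⟨_, ⟨a, ha, rfl⟩, rfl⟩
    refine ⟨fun i => (a i : Fin n → K), fun i => ha ⟨i, rfl⟩, ?_⟩
    rw [wedgeMap, exteriorPower.alternatingMapLinearEquiv_apply_ιMulti]
    rfl
  · rintro ⟨v, hv, rfl⟩
    refine ⟨_, ⟨fun i => ⟨v i, hsL (hv i)⟩, ?_, rfl⟩, ?_⟩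
    · rintro _ ⟨i, rfl⟩
      exact hv i
    · rw [wedgeMap, exteriorPower.alternatingMapLinearEquiv_apply_ιMulti]
      rfl

theorem extendLattice_id (L : Submodule A (Fin n → K)) : extendLattice A (RingHom.id K) L = L := by
  simp [extendLattice]

theorem extendLattice_comp {B K' C K'' : Type*} [CommRing B] [CommRing K'] [Algebra B K']
    [CommRing C] [CommRing K''] [Algebra C K''] (ψ : B →+* C) (φ : K →+* K') (ψ' : K' →+* K'')
    (h : ∀ b, ψ' (algebraMap B K' b) = algebraMap C K'' (ψ b)) (L : Submodule A (Fin n → K)) :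
    extendLattice C (ψ'.comp φ) L = extendLattice C ψ' (extendLattice B φ L) := by
  apply le_antisymm
  · refine Submodule.span_mono ?_
    rintro _ ⟨v, hv, rfl⟩
    exact ⟨_, Submodule.subset_span ⟨v, hv, rfl⟩, rfl⟩
  · refine Submodule.span_le.2 ?_
    rintro _ ⟨w, hw, rfl⟩
    refine Submodule.span_induction (p := fun w _ =>
      (fun i => ψ' (w i)) ∈ extendLattice C (ψ'.comp φ) L) ?_ ?_ ?_ ?_ hw
    · rintro _ ⟨v, hv, rfl⟩
      exact Submodule.subset_span ⟨v, hv, rfl⟩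
    · have h0 : (fun i : Fin n => ψ' ((0 : Fin n → K') i)) = 0 := funext fun i => map_zero ψ'
      rw [h0]
      exact Submodule.zero_mem _
    · intro x y _ _ hx hy
      convert Submodule.add_mem _ hx hy using 1
      ext i; simp
    · intro b x _ hx
      convert Submodule.smul_mem _ (ψ b) hx using 1
      ext i; simp [Algebra.smul_def, h]

theorem isSpecialLattice_extendLattice {B K' : Type*} [CommRing B] [CommRing K'] [Algebra B K']
    (ψ : A →+* B) (φ : K →+* K') (h : ∀ a, φ (algebraMap A K a) = algebraMap B K' (ψ a))
    (hinj : Function.Injective (algebraMap B K'))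
    {L : Submodule A (Fin n → K)} (hL : IsSpecialLattice L) :
    IsSpecialLattice (extendLattice B φ L) := by
  let _ := ψ.toAlgebra
  let _ := φ.toAlgebra
  let _ := ((algebraMap B K').comp ψ).toAlgebra
  have : IsScalarTower A B K' := IsScalarTower.of_algebraMap_eq fun _ => rfl
  have : IsScalarTower A K K' := IsScalarTower.of_algebraMap_eq fun a => (h a).symm
  have := hL.projective
  have hfin : Module.Finite A L := Module.Finite.iff_fg.2 hL.fg
  -- the map `K ^ n → K' ^ n`
  let c : (Fin n → K) →ₗ[K] (Fin n → K') :=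
    LinearMap.pi fun i => Algebra.linearMap K K' ∘ₗ LinearMap.proj i
  have hc : IsBaseChange K' c := IsBaseChange.pi _ fun _ => IsBaseChange.linearMap K K'
  have hcL := hL.isBaseChange.comp hc
  -- the map `B ⊗ L → K' ^ n`
  let l : L →ₗ[A] (Fin n → K') := c.restrictScalars A ∘ₗ L.subtype
  let f : B ⊗[A] L →ₗ[B] (Fin n → K') := l.liftBaseChange B
  have hrange : LinearMap.range f = extendLattice B φ L := by
    rw [LinearMap.range_liftBaseChange]
    refine congrArg (Submodule.span B) ?_
    ext w
    constructor
    · rintro ⟨x, rfl⟩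
      exact ⟨x, x.2, rfl⟩
    · rintro ⟨v, hv, rfl⟩
      exact ⟨⟨v, hv⟩, rfl⟩
  have hf : Function.Injective f := by
    let g : B ⊗[A] L →ₗ[A] K' ⊗[A] L :=
      (IsScalarTower.toAlgHom A B K').toLinearMap.rTensor L
    have hg : Function.Injective g :=
      Module.Flat.rTensor_preserves_injective_linearMap _ hinj
    have hfg : f.restrictScalars A = (hcL.equiv.toLinearMap.restrictScalars A) ∘ₗ g := by
      refine TensorProduct.ext' fun b x => ?_
      change b • l x = hcL.equiv (algebraMap B K' b ⊗ₜ x)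
      rw [hcL.equiv_tmul, algebraMap_smul]
    have : ⇑f = hcL.equiv ∘ g := funext fun x => LinearMap.congr_fun hfg x
    rw [this]
    exact hcL.equiv.injective.comp hg
  let e : B ⊗[A] L ≃ₗ[B] extendLattice B φ L :=
    (LinearEquiv.ofInjective f hf).trans (LinearEquiv.ofEq _ _ hrange)
  have hfgB : Module.Finite B (extendLattice B φ L) := Module.Finite.equiv e
  refine ⟨⟨Module.Finite.iff_fg.1 hfgB, Module.Projective.of_equiv e, ?_⟩, ?_⟩
  · let l' : L →ₗ[A] extendLattice B φ L :=
      (e.toLinearMap.restrictScalars A) ∘ₗ TensorProduct.mk A B L 1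
    have hl' : IsBaseChange B l' := IsBaseChange.of_equiv e fun _ => rfl
    refine hl'.of_comp ?_
    have hcomp : (extendLattice B φ L).subtype.restrictScalars A ∘ₗ l' =
        c.restrictScalars A ∘ₗ L.subtype := by
      refine LinearMap.ext fun x => ?_
      change f (1 ⊗ₜ x) = l x
      exact (LinearMap.liftBaseChange_tmul B l 1 x).trans (one_smul B _)
    rw [hcomp]
    exact hcL
  · rw [wedgeMap_range (extendLattice B φ L) _ rfl]
    have hw := hL.wedge
    rw [wedgeMap_range L L (Submodule.span_eq L)] at hw
    have hdet (v : Fin n → Fin n → K) :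
        Matrix.det (fun i j => φ (v i j)) = φ (Matrix.det v) := (RingHom.map_det φ v).symm
    apply le_antisymm
    · refine Submodule.span_le.2 ?_
      rintro _ ⟨v, hv, rfl⟩
      choose w hw1 hw2 using hv
      have hmem : Matrix.det w ∈ (1 : Submodule A K) :=
        hw ▸ Submodule.subset_span ⟨w, hw1, rfl⟩
      obtain ⟨a, ha⟩ := Submodule.mem_one.1 hmem
      refine Submodule.mem_one.2 ⟨ψ a, ?_⟩
      rw [← h, ha, ← hdet]
      exact congrArg Matrix.det (funext hw2)
    · refine Submodule.one_le.2 ?_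
      have h1 : (1 : K) ∈ Submodule.span A {d | ∃ v : Fin n → (Fin n → K),
          (∀ i, v i ∈ (L : Set (Fin n → K))) ∧ d = Matrix.det v} := by
        rw [hw]; exact Submodule.one_le.1 le_rfl
      rw [← map_one φ]
      refine Submodule.span_induction (p := fun d _ => φ d ∈ Submodule.span B _) ?_ ?_ ?_ ?_ h1
      · rintro _ ⟨v, hv, rfl⟩
        exact Submodule.subset_span ⟨fun i j => φ (v i j), fun i => ⟨v i, hv i, rfl⟩, (hdet v).symm⟩
      · rw [map_zero]; exact Submodule.zero_mem _
      · intro x y _ _ hx hy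
        rw [map_add]; exact Submodule.add_mem _ hx hy
      · intro a x _ hx
        rw [Algebra.smul_def, map_mul, h, ← Algebra.smul_def]
        exact Submodule.smul_mem _ _ hx

end Lattice

/-! ### The fpqc topology on categories of algebras -/

section Site

variable {C : Type*} [Category* C]

/-- Let `U : C ⥤ CommRingCat` be a category of algebras, and view `Cᵒᵖ` as a category of affine
schemes via `R ↦ Spec U(R)`. The fpqc topology on `Cᵒᵖ` is the one generated by the families of
morphisms in `Cᵒᵖ` which form an fpqc covering of schemes. -/
def fpqcTopology (U : C ⥤ CommRingCat.{u}) : GrothendieckTopology Cᵒᵖ :=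
  (AlgebraicGeometry.Scheme.fpqcPrecoverage.comap
    (U.op ⋙ AlgebraicGeometry.Scheme.Spec)).toGrothendieck

/-- A functor on a category of algebras, viewed as a presheaf on the category of affine schemes. -/
abbrev toPresheaf {D : Type*} [Category* D] (F : C ⥤ D) : Cᵒᵖᵒᵖ ⥤ D :=
  unopUnop C ⋙ F

end Site

/-! ### Witt vectors with `p` inverted -/

section Witt

variable (p : ℕ) [Fact p.Prime]

/-- The ring `W(R)[1/p]`. -/
abbrev WittLoc (R : Type u) [CommRing R] : Type u :=
  Localization.Away (p : WittVector p R)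

variable {R S T : Type u} [CommRing R] [CommRing S] [CommRing T]

/-- The homomorphism `W(R)[1/p] → W(S)[1/p]` induced by `R → S`. -/
def wittLocMap (f : R →+* S) : WittLoc p R →+* WittLoc p S :=
  IsLocalization.Away.lift (p : WittVector p R)
    (g := (algebraMap (WittVector p S) (WittLoc p S)).comp (WittVector.map f)) <| by
      simpa using IsLocalization.Away.algebraMap_isUnit (S := WittLoc p S) (p : WittVector p S)

theorem wittLocMap_algebraMap (f : R →+* S) (a : WittVector p R) :
    wittLocMap p f (algebraMap _ _ a) = algebraMap _ (WittLoc p S) (WittVector.map f a) :=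
  IsLocalization.Away.lift_eq _ _ _

theorem wittVector_map_id : WittVector.map (RingHom.id R) = RingHom.id (WittVector p R) := by
  ext; simp

theorem wittVector_map_comp (g : S →+* T) (f : R →+* S) :
    WittVector.map (p := p) (g.comp f) = (WittVector.map g).comp (WittVector.map f) := by
  ext; simp

theorem wittLocMap_id : wittLocMap p (RingHom.id R) = RingHom.id (WittLoc p R) := by
  refine IsLocalization.ringHom_ext (Submonoid.powers (p : WittVector p R)) ?_
  ext a
  simp [wittLocMap_algebraMap]

theorem wittLocMap_comp (g : S →+* T) (f : R →+* S) :
    wittLocMap p (g.comp f) = (wittLocMap p g).comp (wittLocMap p f) := by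
  refine IsLocalization.ringHom_ext (Submonoid.powers (p : WittVector p R)) ?_
  ext a
  simp [wittLocMap_algebraMap, wittVector_map_comp]

theorem algebraMap_wittLoc_injective [PerfectRing R p] (hp : (p : R) = 0) :
    Function.Injective (algebraMap (WittVector p R) (WittLoc p R)) := by
  have hreg : ∀ x : WittVector p R, x * p = 0 → x = 0 := by
    rcases subsingleton_or_nontrivial R with hR | hR
    · intro x _
      ext i
      exact Subsingleton.elim _ _
    · have : CharP R p := by
        obtain ⟨q, hq⟩ := CharP.exists R
        have hdvd := (CharP.cast_eq_zero_iff R q p).1 hp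
        rcases (Nat.dvd_prime Fact.out).1 hdvd with h | h
        · subst h
          exact absurd rfl (CharP.char_ne_one R 1)
        · exact h ▸ hq
      intro x hx
      rw [← WittVector.verschiebung_frobenius] at hx
      have h1 : WittVector.frobenius x = 0 :=
        WittVector.verschiebung_injective p R (by rw [hx, map_zero])
      exact (WittVector.frobenius_bijective p R).1 (by rw [h1, map_zero])
  refine IsLocalization.injective (M := Submonoid.powers (p : WittVector p R)) _ ?_
  refine Submonoid.powers_le.2 (mem_nonZeroDivisors_iff_right.2 hreg)

end Witt

/-! ### The `p`-adic affine Grassmannian -/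

section Grassmannian

variable (p : ℕ) [Fact p.Prime] (k : Type u) [Field k] (n : ℕ)

/-- The `p`-adic loop group `R ↦ SLₙ(W(R)[1/p])` on the category of `k`-algebras. -/
def loopGroup : CommAlgCat.{u} k ⥤ GrpCat.{u} where
  obj R := GrpCat.of (Matrix.SpecialLinearGroup (Fin n) (WittLoc p R))
  map f := GrpCat.ofHom (Matrix.SpecialLinearGroup.map (wittLocMap p f.hom.toRingHom))
  map_id R := by
    ext g i j
    exact RingHom.congr_fun (wittLocMap_id p (R := R)) (g i j)
  map_comp f h := by
    ext g i j
    exact RingHom.congr_fun (wittLocMap_comp p h.hom.toRingHom f.hom.toRingHom) (g i j)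

/-- The positive `p`-adic loop group `R ↦ SLₙ(W(R))` on the category of `k`-algebras. -/
def positiveLoopGroup : CommAlgCat.{u} k ⥤ GrpCat.{u} where
  obj R := GrpCat.of (Matrix.SpecialLinearGroup (Fin n) (WittVector p R))
  map f := GrpCat.ofHom (Matrix.SpecialLinearGroup.map (WittVector.map f.hom.toRingHom))
  map_id R := by
    refine GrpCat.ext fun g => Subtype.ext (Matrix.ext fun i j => ?_)
    exact RingHom.congr_fun (wittVector_map_id p (R := R)) (g i j)
  map_comp f h := by
    refine GrpCat.ext fun g => Subtype.ext (Matrix.ext fun i j => ?_)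
    exact RingHom.congr_fun (wittVector_map_comp p h.hom.toRingHom f.hom.toRingHom) (g i j)

/-- The natural homomorphism from the positive loop group to the loop group. -/
def loopGroupInclusion : positiveLoopGroup p k n ⟶ loopGroup p k n where
  app R := GrpCat.ofHom (Matrix.SpecialLinearGroup.map
    (algebraMap (WittVector p R) (WittLoc p R)))
  naturality R S f := by
    refine GrpCat.ext fun g => Subtype.ext (Matrix.ext fun i j => ?_)
    exact (wittLocMap_algebraMap p f.hom.toRingHom
      ((show Matrix.SpecialLinearGroup (Fin n) (WittVector p R) from g) i j)).symm

/-- The functor of left cosets `R ↦ SLₙ(W(R)[1/p]) / SLₙ(W(R))`. -/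
def cosetFunctor : CommAlgCat.{u} k ⥤ Type u where
  obj R := (loopGroup p k n).obj R ⧸ ((loopGroupInclusion p k n).app R).hom.range
  map {R S} f := TypeCat.ofHom <| Quotient.map' ((loopGroup p k n).map f) <| by
    intro a b hab
    rw [QuotientGroup.leftRel_apply] at hab ⊢
    obtain ⟨c, hc⟩ := hab
    refine ⟨(positiveLoopGroup p k n).map f c, ?_⟩
    have h1 := ConcreteCategory.congr_hom ((loopGroupInclusion p k n).naturality f) c
    refine h1.trans ?_
    refine (congrArg ((loopGroup p k n).map f).hom hc).trans ?_
    simp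
  map_id R := by
    ext x
    induction x using Quotient.inductionOn' with
    | h g => exact congrArg Quotient.mk'' (by simp)
  map_comp f h := by
    ext x
    induction x using Quotient.inductionOn' with
    | h g => exact congrArg Quotient.mk'' (by simp)

/-- The `p`-adic affine Grassmannian: the fpqc-sheafification of
`R ↦ SLₙ(W(R)[1/p]) / SLₙ(W(R))` on the category of `k`-algebras. The fpqc site is a large category,
so that the sheafification takes values in the next universe. -/
def grassmannian :
    Sheaf (fpqcTopology (forget₂ (CommAlgCat.{u} k) CommRingCat.{u})) (Type (u + 1)) :=
  (presheafToSheaf _ _).obj (toPresheaf (cosetFunctor p k n ⋙ uliftFunctor.{u + 1}))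

/-- The point of the Grassmannian over `R` defined by an element of `SLₙ(W(R)[1/p])`. -/
def grassmannianMk (R : CommAlgCat.{u} k) (g : Matrix.SpecialLinearGroup (Fin n) (WittLoc p R)) :
    (grassmannian p k n).obj.obj (Opposite.op (Opposite.op R)) :=
  (toSheafify (fpqcTopology (forget₂ (CommAlgCat.{u} k) CommRingCat.{u}))
    (toPresheaf (cosetFunctor p k n ⋙ uliftFunctor.{u + 1}))).app (Opposite.op (Opposite.op R))
    (ULift.up (QuotientGroup.mk g))

/-- The category of perfect `k`-algebras. -/
abbrev PerfectAlg : Type (u + 1) :=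
  ObjectProperty.FullSubcategory (fun R : CommAlgCat.{u} k => PerfectRing R p)

/-- The forgetful functor from perfect `k`-algebras to commutative rings. -/
abbrev PerfectAlg.toCommRing : PerfectAlg p k ⥤ CommRingCat.{u} :=
  ObjectProperty.ι _ ⋙ forget₂ (CommAlgCat.{u} k) CommRingCat.{u}

/-- The restriction of the Grassmannian to the category of perfect `k`-algebras. -/
def perfectGrassmannian : PerfectAlg p k ⥤ Type (u + 1) :=
  ObjectProperty.ι _ ⋙ opOp (CommAlgCat.{u} k) ⋙ (grassmannian p k n).obj

variable [CharP k p]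

/-- The functor of special lattices `R ↦ {L ⊆ W(R)[1/p]ⁿ a special lattice over W(R)}` on perfect
`k`-algebras. A homomorphism `R → S` sends `L` to `L ⊗ W(S)`, embedded in `W(S)[1/p]ⁿ`. -/
def specialLattices : PerfectAlg p k ⥤ Type u where
  obj R := {L : Submodule (WittVector p R.obj) (Fin n → WittLoc p R.obj) // IsSpecialLattice L}
  map {R S} f := TypeCat.ofHom fun L =>
    ⟨extendLattice (WittVector p S.obj) (wittLocMap p f.hom.hom.toRingHom) L.1, by
      have := S.property
      have hp : (p : S.obj) = 0 := by
        rw [← map_natCast (algebraMap k S.obj), CharP.cast_eq_zero, map_zero]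
      exact isSpecialLattice_extendLattice (WittVector.map f.hom.hom.toRingHom) _
        (wittLocMap_algebraMap p _) (algebraMap_wittLoc_injective p hp) L.2⟩
  map_id R := by
    refine ConcreteCategory.hom_ext _ _ fun L => Subtype.ext ?_
    refine (congrArg (fun φ => extendLattice (WittVector p R.obj) φ L.1)
      (wittLocMap_id p (R := R.obj))).trans (extendLattice_id _)
  map_comp {R S T} f h := by
    refine ConcreteCategory.hom_ext _ _ fun L => Subtype.ext ?_
    refine (congrArg (fun φ => extendLattice (WittVector p T.obj) φ L.1)
      (wittLocMap_comp p h.hom.hom.toRingHom f.hom.hom.toRingHom)).trans ?_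
    exact extendLattice_comp (WittVector.map h.hom.hom.toRingHom) _ _ (wittLocMap_algebraMap p _) _

end Grassmannian

end PadicGrass

end

/-!
Write `W = W(R)` and `K = W(R)[1/p]`. Everything rests on a description of special lattices by
determinants. By Cramer's rule `det v • w = ∑ i, det (v₁, …, w, …, vₙ) • vᵢ`, so if a linear
combination of determinants `det v` of vectors of `L` is `1`, then these determinants provide a
finite dual basis of `L`. Hence a submodule `L` of `K ^ n` is a special lattice as soon as the
determinants of its vectors lie in `W` and generate it (`IsSpecialLattice.of_det`), and `L` then
contains every vector all of whose determinants with vectors of `L` are integral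
(`mem_of_det_update_mem`). Over a perfect ring, a Witt vector is divisible by `p ^ m` if and only
if its first `m` components vanish, so that integrality can be tested on a cover
(`mem_range_algebraMap_of_forall`); this gives separatedness of the presheaf of special lattices.

For the gluing, an fpqc cover of affine schemes may be replaced by a finite faithfully flat family
`R → Sᵢ` (`mem_fpqcTopology_iff`). The rings `W(Sᵢ)` are flat over `W(R)` modulo every power of `p`
(`flatMod_witt`), and `W(Sᵢ) ⊗ W(Sⱼ) → W(Sᵢ ⊗ Sⱼ)` is bijective modulo every power of `p`
(`bijectiveMod_wittTensorMap`), because these statements hold modulo `p` and `p` is regular.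
Lattices contain `p ^ m W ^ n` for some `m`, so faithfully flat descent modulo `p ^ m` applies
(`mem_span_of_descent`): the vectors over `K` that lie in all the given lattices generate each of
them, and the determinant criterion shows that they form a special lattice.

For the comparison, the map `g ↦ g • W ^ n` is injective on cosets, since the stabilizer of `W ^ n`
in `SLₙ(K)` is `SLₙ(W)`, and it is locally surjective: a special lattice becomes a translate of
`W ^ n` after inverting the reduction modulo `p` of a determinant, and the reductions of these
determinants generate the unit ideal (`containsFlatCover_cosetToLattice`). It remains to see that
sheafification commutes with the restriction to perfect algebras. A flat cover of a perfect ring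
stays flat after passing to perfections (`flat_comp_of_isPRadical`), so the inclusion of affine
perfect schemes into affine schemes is cocontinuous; it is continuous since tensor products of
perfect rings are perfect. Hence the restricted Grassmannian is a sheaf and receives a locally
bijective map from the coset functor, as does the sheaf of special lattices, and the two are
isomorphic compatibly with these maps.
-/

noncomputable section

namespace PadicGrass

/-! ### Special lattices and determinants -/

section Lattice

variable {A K : Type*} [CommRing A] [CommRing K] [Algebra A K] {n : ℕ}

/-- Cramer's rule, for the rows `v i` of a matrix. -/
theorem det_smul_eq_sum (v : Fin n → Fin n → K) (w : Fin n → K) :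
    Matrix.det v • w = ∑ i, Matrix.det (Function.update v i w) • v i := by
  have h := Matrix.mulVec_cramer (Matrix.of v).transpose w
  rw [Matrix.det_transpose] at h
  refine h.symm.trans ?_
  ext j
  simp [Matrix.mulVec, dotProduct, Matrix.cramer_transpose_apply, Matrix.updateRow, mul_comm]
  rfl

/-- `w ↦ det (v₁, …, w, …, vₙ)`, with `w` in place `i`, as an `A`-linear map. -/
def detUpdate (A : Type*) [CommRing A] [Algebra A K] (v : Fin n → Fin n → K) (i : Fin n) :
    (Fin n → K) →ₗ[A] K :=
  (detAlternating A K n).toMultilinearMap.toLinearMap v i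

theorem detUpdate_apply (v : Fin n → Fin n → K) (i : Fin n) (w : Fin n → K) :
    detUpdate A v i w = Matrix.det (Function.update v i w) := rfl

theorem IsSpecialLattice.det_mem {L : Submodule A (Fin n → K)} (hL : IsSpecialLattice L)
    {v : Fin n → Fin n → K} (hv : ∀ i, v i ∈ L) : Matrix.det v ∈ (1 : Submodule A K) := by
  rw [← hL.wedge, wedgeMap_range L L (Submodule.span_eq L)]
  exact Submodule.subset_span ⟨v, hv, rfl⟩

theorem IsSpecialLattice.one_mem_span {L : Submodule A (Fin n → K)} (hL : IsSpecialLattice L) :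
    (1 : K) ∈ Submodule.span A {d | ∃ v : Fin n → (Fin n → K), (∀ i, v i ∈ L) ∧
      d = Matrix.det v} := by
  have h := wedgeMap_range L L (Submodule.span_eq L)
  rw [hL.wedge] at h
  exact h ▸ Submodule.one_le.1 le_rfl

theorem exists_sum_det_eq_one {L : Submodule A (Fin n → K)}
    (h : (1 : K) ∈ Submodule.span A {d | ∃ v : Fin n → (Fin n → K), (∀ i, v i ∈ L) ∧
      d = Matrix.det v}) :
    ∃ (m : ℕ) (a : Fin m → A) (v : Fin m → Fin n → Fin n → K),
      (∀ j i, v j i ∈ L) ∧ ∑ j, a j • Matrix.det (v j) = 1 := by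
  obtain ⟨m, a, g, hg⟩ := Submodule.mem_span_set'.1 h
  choose v hv hd using fun j => (g j).2
  exact ⟨m, a, v, hv, by simp_rw [← hd]; exact hg⟩

theorem sum_smul_det_update {m : ℕ} {a : Fin m → A} {v : Fin m → Fin n → Fin n → K}
    (h : ∑ j, a j • Matrix.det (v j) = 1) (w : Fin n → K) :
    w = ∑ j, a j • ∑ i, Matrix.det (Function.update (v j) i w) • v j i := by
  simp_rw [← det_smul_eq_sum, ← smul_assoc, ← Finset.sum_smul, h, one_smul]

/-- A special lattice is its own dual with respect to the determinant: it contains every vector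
`w` such that all determinants of `w` with vectors of the lattice are integral. -/
theorem mem_of_det_update_mem {L : Submodule A (Fin n → K)}
    (h : (1 : K) ∈ Submodule.span A {d | ∃ v : Fin n → (Fin n → K), (∀ i, v i ∈ L) ∧
      d = Matrix.det v}) {w : Fin n → K}
    (hw : ∀ v : Fin n → Fin n → K, (∀ i, v i ∈ L) → ∀ i,
      Matrix.det (Function.update v i w) ∈ (1 : Submodule A K)) : w ∈ L := by
  obtain ⟨m, a, v, hv, hs⟩ := exists_sum_det_eq_one h
  rw [sum_smul_det_update hs w]
  refine Submodule.sum_mem _ fun j _ => Submodule.smul_mem _ _ (Submodule.sum_mem _ fun i _ => ?_)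
  obtain ⟨c, hc⟩ := Submodule.mem_one.1 (hw (v j) (hv j) i)
  rw [← hc, algebraMap_smul]
  exact Submodule.smul_mem _ _ (hv j i)

/-- If `K` is a localization of `A`, the condition on determinants alone makes a submodule of
`K ^ n` a special lattice: Cramer's rule turns a partition of unity by determinants into a finite
dual basis. -/
theorem IsSpecialLattice.of_det (M : Submonoid A) [IsLocalization M K]
    (hinj : Function.Injective (algebraMap A K)) {L : Submodule A (Fin n → K)}
    (hdet : ∀ v : Fin n → Fin n → K, (∀ i, v i ∈ L) → Matrix.det v ∈ (1 : Submodule A K))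
    (hone : (1 : K) ∈ Submodule.span A {d | ∃ v : Fin n → (Fin n → K), (∀ i, v i ∈ L) ∧
      d = Matrix.det v}) : IsSpecialLattice L := by
  obtain ⟨m, a, v, hv, hs⟩ := exists_sum_det_eq_one hone
  have hupd (j : Fin m) (i : Fin n) (w : Fin n → K) (hw : w ∈ L) :
      detUpdate A (v j) i w ∈ (1 : Submodule A K) := by
    refine hdet _ fun i' => ?_
    rcases eq_or_ne i' i with rfl | hi
    · simpa using hw
    · simpa [hi] using hv j i'
  let e : A ≃ₗ[A] (1 : Submodule A K) :=
    (LinearEquiv.ofInjective (Algebra.linearMap A K) hinj).trans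
      (LinearEquiv.ofEq _ _ (Submodule.one_eq_range).symm)
  have he (x : (1 : Submodule A K)) : algebraMap A K (e.symm x) = x := by
    obtain ⟨y, rfl⟩ := e.surjective x
    rw [e.symm_apply_apply]; rfl
  let φ (j : Fin m) (i : Fin n) : L →ₗ[A] A :=
    e.symm.toLinearMap ∘ₗ ((detUpdate A (v j) i).domRestrict L).codRestrict 1
      fun w => hupd j i w w.2
  have hφ (j i) (w : L) : algebraMap A K (φ j i w) = Matrix.det (Function.update (v j) i w) :=
    he _
  let s : L →ₗ[A] (Fin m × Fin n → A) := LinearMap.pi fun x => φ x.1 x.2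
  let π : (Fin m × Fin n → A) →ₗ[A] L :=
    Fintype.linearCombination A fun x : Fin m × Fin n => a x.1 • (⟨v x.1 x.2, hv _ _⟩ : L)
  have hπ : π ∘ₗ s = LinearMap.id := by
    ext w : 1
    refine Subtype.ext ?_
    change ((π (s w) : L) : Fin n → K) = w
    conv_rhs => rw [sum_smul_det_update hs (w : Fin n → K)]
    rw [Fintype.linearCombination_apply, Fintype.sum_prod_type]
    rw [AddSubmonoidClass.coe_finsetSum]
    refine Finset.sum_congr rfl fun j _ => ?_
    rw [AddSubmonoidClass.coe_finsetSum, Finset.smul_sum]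
    refine Finset.sum_congr rfl fun i _ => ?_
    change φ j i w • a j • v j i = _
    rw [← hφ, algebraMap_smul, smul_comm]
  have hsurj : Function.Surjective π := fun w => ⟨s w, LinearMap.congr_fun hπ w⟩
  have hfin : Module.Finite A L := Module.Finite.of_surjective π hsurj
  refine ⟨⟨Module.Finite.iff_fg.1 hfin, Module.Projective.of_split s π hπ, ?_⟩, ?_⟩
  · rw [← isLocalizedModule_iff_isBaseChange M]
    refine ⟨fun x => ?_, fun w => ?_, fun {x y} h => ⟨1, by simpa using Subtype.ext h⟩⟩
    · refine (Module.End.isUnit_iff _).2 ?_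
      have hu := IsLocalization.map_units K x
      constructor
      · intro w w' h
        have h' : algebraMap A K x • w = algebraMap A K x • w' := by
          simp only [Module.algebraMap_end_apply] at h
          simpa only [algebraMap_smul] using h
        exact (hu.smul_left_cancel).1 h'
      · intro w
        refine ⟨((hu.unit⁻¹ : Kˣ) : K) • w, ?_⟩
        rw [Module.algebraMap_end_apply, ← algebraMap_smul K, smul_smul, hu.mul_val_inv, one_smul]
    · obtain ⟨b, hb⟩ := IsLocalization.exist_integer_multiples_of_finite M
        fun x : Fin m × Fin n => Matrix.det (Function.update (v x.1) x.2 w)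
      have hmem : (b : A) • w ∈ L := by
        rw [sum_smul_det_update hs w, Finset.smul_sum]
        refine Submodule.sum_mem _ fun j _ => ?_
        rw [smul_comm, Finset.smul_sum]
        refine Submodule.smul_mem _ _ (Submodule.sum_mem _ fun i _ => ?_)
        obtain ⟨c, hc⟩ := hb (j, i)
        rw [← smul_assoc, ← hc, algebraMap_smul]
        exact Submodule.smul_mem _ _ (hv j i)
      exact ⟨(⟨_, hmem⟩, b), rfl⟩
  · rw [wedgeMap_range L L (Submodule.span_eq L)]
    refine le_antisymm (Submodule.span_le.2 ?_) (Submodule.one_le.2 hone)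
    rintro _ ⟨w, hw, rfl⟩
    exact hdet w hw

theorem mem_matrixSMul_standardLattice {g : Matrix (Fin n) (Fin n) K} {w : Fin n → K} :
    w ∈ matrixSMul g (standardLattice A K n) ↔
      ∃ c : Fin n → A, w = g.mulVec fun i => algebraMap A K (c i) := by
  constructor
  · rintro ⟨_, ⟨c, rfl⟩, rfl⟩
    exact ⟨c, rfl⟩
  · rintro ⟨c, rfl⟩
    exact ⟨_, ⟨c, rfl⟩, rfl⟩

theorem mulVec_algebraMap_single (g : Matrix (Fin n) (Fin n) K) (i : Fin n) :
    g.mulVec (fun j => algebraMap A K (Pi.single (M := fun _ => A) i 1 j)) = g.col i := by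
  have : (fun j => algebraMap A K (Pi.single (M := fun _ => A) i 1 j)) = Pi.single i 1 := by
    funext j
    rcases eq_or_ne j i with rfl | h <;> simp [*]
  rw [this, Matrix.mulVec_single_one]

theorem col_mem_matrixSMul_standardLattice (g : Matrix (Fin n) (Fin n) K) (i : Fin n) :
    g.col i ∈ matrixSMul g (standardLattice A K n) :=
  mem_matrixSMul_standardLattice.2 ⟨Pi.single i 1, (mulVec_algebraMap_single g i).symm⟩

theorem isSpecialLattice_matrixSMul (M : Submonoid A) [IsLocalization M K]
    (hinj : Function.Injective (algebraMap A K)) {g : Matrix (Fin n) (Fin n) K} (hg : g.det = 1) :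
    IsSpecialLattice (matrixSMul g (standardLattice A K n)) := by
  refine .of_det M hinj (fun v hv => ?_) (Submodule.subset_span ⟨g.transpose, fun i => ?_, ?_⟩)
  · choose c hc using fun i => mem_matrixSMul_standardLattice.1 (hv i)
    have h : v = (g * (Matrix.transpose (Matrix.of c)).map (algebraMap A K)).transpose := by
      funext i j
      rw [hc i]
      rfl
    rw [h, Matrix.det_transpose, Matrix.det_mul, hg, one_mul]
    exact Submodule.mem_one.2 ⟨_, RingHom.map_det _ _⟩
  · exact col_mem_matrixSMul_standardLattice g i
  · rw [Matrix.det_transpose, hg]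

theorem matrixSMul_mul_map_le
    (g : Matrix.SpecialLinearGroup (Fin n) K) (c : Matrix.SpecialLinearGroup (Fin n) A) :
    matrixSMul (g * Matrix.SpecialLinearGroup.map (algebraMap A K) c).1 (standardLattice A K n) ≤
      matrixSMul g.1 (standardLattice A K n) := by
  intro w hw
  obtain ⟨x, rfl⟩ := mem_matrixSMul_standardLattice.1 hw
  refine mem_matrixSMul_standardLattice.2 ⟨c.1.mulVec x, ?_⟩
  have h : (fun i => algebraMap A K (c.1.mulVec x i)) =
      (c.1.map (algebraMap A K)).mulVec fun i => algebraMap A K (x i) :=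
    funext fun i => RingHom.map_mulVec (algebraMap A K) c.1 x i
  rw [h, Matrix.mulVec_mulVec]
  rfl

/-- The lattice `g • A ^ n` only depends on the coset of `g` modulo `SLₙ(A)`. -/
theorem matrixSMul_mul_map
    (g : Matrix.SpecialLinearGroup (Fin n) K) (c : Matrix.SpecialLinearGroup (Fin n) A) :
    matrixSMul (g * Matrix.SpecialLinearGroup.map (algebraMap A K) c).1 (standardLattice A K n) =
      matrixSMul g.1 (standardLattice A K n) := by
  refine le_antisymm (matrixSMul_mul_map_le g c) ?_
  have h := matrixSMul_mul_map_le (g * Matrix.SpecialLinearGroup.map (algebraMap A K) c) c⁻¹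
  rwa [map_inv, mul_inv_cancel_right] at h

theorem extendLattice_matrixSMul {B K' : Type*} [CommRing B] [CommRing K'] [Algebra B K']
    (ψ : A →+* B) (φ : K →+* K') (h : ∀ a, φ (algebraMap A K a) = algebraMap B K' (ψ a))
    (g : Matrix (Fin n) (Fin n) K) :
    extendLattice B φ (matrixSMul g (standardLattice A K n)) =
      matrixSMul (g.map φ) (standardLattice B K' n) := by
  apply le_antisymm
  · refine Submodule.span_le.2 ?_
    rintro _ ⟨w, hw, rfl⟩
    obtain ⟨c, rfl⟩ := mem_matrixSMul_standardLattice.1 hw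
    refine mem_matrixSMul_standardLattice.2 ⟨fun i => ψ (c i), ?_⟩
    funext i
    simp [Matrix.mulVec, dotProduct, h]
  · intro w hw
    obtain ⟨c, rfl⟩ := mem_matrixSMul_standardLattice.1 hw
    have : (g.map φ).mulVec (fun i => algebraMap B K' (c i)) =
        ∑ i, c i • fun j => φ (g j i) := by
      funext j
      simp [Matrix.mulVec, dotProduct, Algebra.smul_def, mul_comm]
    rw [this]
    refine Submodule.sum_mem _ fun i _ => Submodule.smul_mem _ _ (Submodule.subset_span ?_)
    exact ⟨g.col i, col_mem_matrixSMul_standardLattice g i, rfl⟩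

/-- The stabilizer of the standard lattice in `SLₙ(K)` is `SLₙ(A)`. -/
theorem exists_map_eq_of_matrixSMul_eq (hinj : Function.Injective (algebraMap A K))
    {g h : Matrix.SpecialLinearGroup (Fin n) K}
    (hgh : matrixSMul g.1 (standardLattice A K n) = matrixSMul h.1 (standardLattice A K n)) :
    ∃ c : Matrix.SpecialLinearGroup (Fin n) A,
      Matrix.SpecialLinearGroup.map (algebraMap A K) c = g⁻¹ * h := by
  have hcol (i : Fin n) : ∃ c : Fin n → A,
      h.1.col i = g.1.mulVec fun i => algebraMap A K (c i) := by
    rw [← mem_matrixSMul_standardLattice, hgh]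
    exact col_mem_matrixSMul_standardLattice h.1 i
  choose c hc using hcol
  have hmul : h.1 = g.1 * (Matrix.of c).transpose.map (algebraMap A K) := by
    ext i j
    exact congrFun (hc j) i
  have hdet : (Matrix.of c).transpose.det = 1 := by
    apply hinj
    have h1 := congrArg Matrix.det hmul
    rw [Matrix.det_mul, g.2, h.2, one_mul] at h1
    rw [map_one, RingHom.map_det]
    exact h1.symm
  refine ⟨⟨_, hdet⟩, ?_⟩
  rw [eq_inv_mul_iff_mul_eq]
  exact Subtype.ext hmul.symm

/-- A special lattice containing vectors whose determinant is a unit of `A` is a translate of the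
standard lattice. -/
theorem IsSpecialLattice.exists_eq_matrixSMul {L : Submodule A (Fin n → K)}
    (hL : IsSpecialLattice L) {v : Fin n → Fin n → K} (hv : ∀ i, v i ∈ L) {d : A}
    (hd : IsUnit d) (hvd : Matrix.det v = algebraMap A K d) :
    ∃ g : Matrix.SpecialLinearGroup (Fin n) K, L = matrixSMul g.1 (standardLattice A K n) := by
  obtain ⟨v', hv', hdet⟩ : ∃ v' : Fin n → Fin n → K, (∀ i, v' i ∈ L) ∧ Matrix.det v' = 1 := by
    rcases n with _ | n
    · exact ⟨v, hv, Matrix.det_isEmpty⟩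
    · obtain ⟨u, rfl⟩ := hd
      refine ⟨Function.update v 0 ((↑u⁻¹ : A) • v 0), fun i => ?_, ?_⟩
      · rcases eq_or_ne i 0 with rfl | hi
        · simpa only [Function.update_self] using L.smul_mem _ (hv 0)
        · simpa [hi] using hv i
      · change detUpdate A v 0 _ = _
        rw [map_smul, detUpdate_apply, Function.update_eq_self, hvd, Algebra.smul_def, ← map_mul,
          Units.inv_mul, map_one]
  refine ⟨⟨(Matrix.of v').transpose, (Matrix.det_transpose _).trans hdet⟩, le_antisymm ?_ ?_⟩
  · intro w hw
    have hmem (i : Fin n) : Matrix.det (Function.update v' i w) ∈ (1 : Submodule A K) := by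
      refine hL.det_mem fun j => ?_
      rcases eq_or_ne j i with rfl | hi
      · simpa using hw
      · simpa [hi] using hv' j
    choose c hc using fun i => Submodule.mem_one.1 (hmem i)
    refine mem_matrixSMul_standardLattice.2 ⟨c, ?_⟩
    have h := det_smul_eq_sum v' w
    rw [hdet, one_smul] at h
    rw [h]
    ext j
    simp [Matrix.mulVec, dotProduct, hc, mul_comm]
  · intro w hw
    obtain ⟨c, rfl⟩ := mem_matrixSMul_standardLattice.1 hw
    change (Matrix.of v').transpose.mulVec _ ∈ L
    have : (Matrix.of v').transpose.mulVec (fun i => algebraMap A K (c i)) = ∑ i, c i • v' i := by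
      ext j
      simp [Matrix.mulVec, dotProduct, Algebra.smul_def, mul_comm]
    rw [this]
    exact Submodule.sum_mem _ fun i _ => Submodule.smul_mem _ _ (hv' i)

end Lattice

/-! ### Witt vectors of perfect rings -/

section Witt

variable {p : ℕ} [Fact p.Prime] {R : Type u} [CommRing R]

theorem charP_of_natCast_eq_zero [Nontrivial R] (hp : (p : R) = 0) : CharP R p := by
  obtain ⟨q, hq⟩ := CharP.exists R
  rcases (Nat.dvd_prime Fact.out).1 ((CharP.cast_eq_zero_iff R q p).1 hp) with h | h
  · subst h
    exact absurd rfl (CharP.char_ne_one R 1)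
  · exact h ▸ hq

instance [Subsingleton R] : Subsingleton (WittVector p R) :=
  ⟨fun x y => by ext i; exact Subsingleton.elim _ _⟩

theorem witt_pow_dvd_iff [PerfectRing R p] (hp : (p : R) = 0) (m : ℕ) (x : WittVector p R) :
    (p : WittVector p R) ^ m ∣ x ↔ ∀ i < m, x.coeff i = 0 := by
  rcases subsingleton_or_nontrivial R with hR | hR
  · exact ⟨fun _ _ _ => Subsingleton.elim _ _, fun _ => ⟨0, Subsingleton.elim _ _⟩⟩
  · have := charP_of_natCast_eq_zero hp
    rw [← Ideal.mem_span_singleton]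
    exact WittVector.mem_span_p_pow_iff_le_coeff_eq_zero x m

theorem witt_dvd_iff [PerfectRing R p] (hp : (p : R) = 0) (x : WittVector p R) :
    (p : WittVector p R) ∣ x ↔ WittVector.constantCoeff x = 0 := by
  simpa using witt_pow_dvd_iff hp 1 x

theorem witt_eq_zero_of_p_mul [PerfectRing R p] (hp : (p : R) = 0) (x : WittVector p R)
    (h : (p : WittVector p R) * x = 0) : x = 0 := by
  apply algebraMap_wittLoc_injective p hp
  rw [map_zero]
  have hu := IsLocalization.Away.algebraMap_isUnit (S := WittLoc p R) (p : WittVector p R)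
  rw [← hu.mul_right_eq_zero, ← map_mul, h, map_zero]

/-- As `W(R)` is `p`-adically complete, `p` lies in its Jacobson radical. -/
theorem witt_p_mem_jacobson [PerfectRing R p] (hp : (p : R) = 0) :
    (p : WittVector p R) ∈ (⊥ : Ideal (WittVector p R)).jacobson := by
  rcases subsingleton_or_nontrivial R with hR | hR
  · rw [Subsingleton.elim (p : WittVector p R) 0]; exact zero_mem _
  · have := charP_of_natCast_eq_zero hp
    exact IsAdicComplete.le_jacobson_bot (Ideal.span {(p : WittVector p R)})
      (Ideal.mem_span_singleton_self _)

/-- A Witt vector over a perfect ring is invertible if and only if its reduction modulo `p` is. -/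
theorem witt_isUnit_iff [PerfectRing R p] (hp : (p : R) = 0) (x : WittVector p R) :
    IsUnit x ↔ IsUnit (WittVector.constantCoeff x) := by
  refine ⟨fun h => h.map _, fun h => ?_⟩
  obtain ⟨b, hb⟩ := h.exists_right_inv
  obtain ⟨y, rfl⟩ := WittVector.constantCoeff_surjective p b
  obtain ⟨z, hz⟩ := (witt_dvd_iff hp (x * y - 1)).2 (by
    rw [map_sub, map_mul, hb, map_one, sub_self])
  have h := Ideal.mem_jacobson_bot.1 (witt_p_mem_jacobson hp) z
  rw [← hz, sub_add_cancel] at h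
  exact isUnit_of_mul_isUnit_left h

theorem witt_ideal_eq_top [PerfectRing R p] (hp : (p : R) = 0) {I : Ideal (WittVector p R)}
    (h : I.map (WittVector.constantCoeff : WittVector p R →+* R) = ⊤) : I = ⊤ := by
  have h1 : (1 : R) ∈ I.map (WittVector.constantCoeff : WittVector p R →+* R) := h ▸ trivial
  obtain ⟨x, hx, hx1⟩ :=
    (Ideal.mem_map_iff_of_surjective _ (WittVector.constantCoeff_surjective p)).1 h1
  exact I.eq_top_of_isUnit_mem hx ((witt_isUnit_iff hp x).2 (hx1 ▸ isUnit_one))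

theorem exists_pow_mul_eq_algebraMap (x : WittLoc p R) :
    ∃ (N : ℕ) (a : WittVector p R), (p : WittLoc p R) ^ N * x = algebraMap _ _ a := by
  obtain ⟨N, a, h⟩ := IsLocalization.Away.surj (p : WittVector p R) x
  exact ⟨N, a, by rw [← h, mul_comm]; simp⟩

theorem isUnit_p_wittLoc : IsUnit (p : WittLoc p R) := by
  simpa using IsLocalization.Away.algebraMap_isUnit (S := WittLoc p R) (p : WittVector p R)

/-- Integrality can be tested after a jointly injective family of homomorphisms of perfect rings,
since divisibility by a power of `p` is the vanishing of Witt components. -/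
theorem mem_range_algebraMap_of_forall [PerfectRing R p] (hp : (p : R) = 0) {ι : Type*}
    {S : ι → Type u} [∀ i, CommRing (S i)] [∀ i, PerfectRing (S i) p] (hS : ∀ i, (p : S i) = 0)
    (f : ∀ i, R →+* S i) (hf : ∀ r, (∀ i, f i r = 0) → r = 0) (x : WittLoc p R)
    (hx : ∀ i, wittLocMap p (f i) x ∈ (algebraMap (WittVector p (S i)) (WittLoc p (S i))).range) :
    x ∈ (algebraMap (WittVector p R) (WittLoc p R)).range := by
  obtain ⟨N, a, ha⟩ := exists_pow_mul_eq_algebraMap x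
  have hdvd : (p : WittVector p R) ^ N ∣ a := by
    rw [witt_pow_dvd_iff hp]
    intro m hm
    refine hf _ fun i => ?_
    obtain ⟨b, hb⟩ := hx i
    have h1 := congrArg (wittLocMap p (f i)) ha
    rw [wittLocMap_algebraMap, map_mul, ← hb, map_pow, map_natCast] at h1
    have h2 : (p : WittVector p (S i)) ^ N * b = WittVector.map (f i) a := by
      apply algebraMap_wittLoc_injective p (hS i)
      rw [← h1]; simp
    rw [← WittVector.map_coeff]
    exact (witt_pow_dvd_iff (hS i) N _).1 ⟨b, h2.symm⟩ m hm
  obtain ⟨c, rfl⟩ := hdvd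
  refine ⟨c, ((isUnit_p_wittLoc (p := p) (R := R)).pow N).mul_left_cancel ?_⟩
  rw [ha]; simp

end Witt

/-! ### Flatness modulo an element -/

section FlatMod

variable {A : Type*} [CommRing A]

/-- `M` is flat modulo `q`, that is, `M / q M` is flat over `A / q A`; this is the equational
criterion for flatness, spelled out in terms of `A` and `M`. -/
def FlatMod (q : A) (M : Type*) [AddCommGroup M] [Module A M] : Prop :=
  ∀ (l : ℕ) (f : Fin l → A) (x : Fin l → M), (∃ z, ∑ i, f i • x i = q • z) →
    ∃ (k : ℕ) (a : Fin l → Fin k → A) (y : Fin k → M),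
      (∀ i, ∃ z, x i = ∑ j, a i j • y j + q • z) ∧ ∀ j, q ∣ ∑ i, f i * a i j

variable {M : Type*} [AddCommGroup M] [Module A M]

theorem FlatMod.exists_of_fintype {q : A} (h : FlatMod q M) {ι : Type*} [Fintype ι]
    (f : ι → A) (x : ι → M) (hx : ∃ z, ∑ i, f i • x i = q • z) :
    ∃ (k : ℕ) (a : ι → Fin k → A) (y : Fin k → M),
      (∀ i, ∃ z, x i = ∑ j, a i j • y j + q • z) ∧ ∀ j, q ∣ ∑ i, f i * a i j := by
  let e := Fintype.equivFin ι
  obtain ⟨k, a, y, h1, h2⟩ := h _ (f ∘ e.symm) (x ∘ e.symm) (by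
    simpa only [Function.comp_apply, e.symm.sum_comp (fun i => f i • x i)] using hx)
  refine ⟨k, fun i => a (e i), y, fun i => by simpa using h1 (e i), fun j => ?_⟩
  rw [← e.symm.sum_comp]
  simpa using h2 j

theorem flatMod_of_fintype {q : A} {l : ℕ} {f : Fin l → A} {x : Fin l → M} {κ : Type*} [Fintype κ]
    (a : Fin l → κ → A) (y : κ → M)
    (h1 : ∀ i, ∃ z, x i = ∑ j, a i j • y j + q • z) (h2 : ∀ j, q ∣ ∑ i, f i * a i j) :
    ∃ (k : ℕ) (a : Fin l → Fin k → A) (y : Fin k → M),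
      (∀ i, ∃ z, x i = ∑ j, a i j • y j + q • z) ∧ ∀ j, q ∣ ∑ i, f i * a i j := by
  let e := Fintype.equivFin κ
  refine ⟨_, fun i j => a i (e.symm j), y ∘ e.symm, fun i => ?_, fun j => h2 _⟩
  simpa only [Function.comp_apply, e.symm.sum_comp (fun j => a i j • y j)] using h1 i

/-- A version of the local criterion of flatness: if `π` is regular on `M`, and `M` is
flat modulo `π`, then `M` is flat modulo every power of `π`. -/
theorem FlatMod.pow {π : A} (h : FlatMod π M) (hM : ∀ x : M, π • x = 0 → x = 0) (m : ℕ) :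
    FlatMod (π ^ m) M := by
  induction m with
  | zero =>
    intro l f x _
    exact ⟨0, fun _ => Fin.elim0, Fin.elim0, fun i => ⟨x i, by simp⟩, fun j => j.elim0⟩
  | succ m ih =>
    rintro l f x ⟨z, hz⟩
    obtain ⟨k, c, y, hc, hd⟩ := h l f x ⟨π ^ m • z, by rw [hz, smul_smul, pow_succ']⟩
    choose x' hx' using hc
    choose d hd using hd
    have hsum : ∑ s : Fin k ⊕ Fin l, Sum.elim d f s • Sum.elim y x' s = π ^ m • z := by
      rw [← sub_eq_zero]
      apply hM
      rw [smul_sub, sub_eq_zero, smul_smul, ← pow_succ', ← hz, Fintype.sum_sum_type, smul_add,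
        Finset.smul_sum, Finset.smul_sum]
      simp only [Sum.elim_inl, Sum.elim_inr]
      have h1 : ∀ i, f i • x i = ∑ j, (f i * c i j) • y j + π • f i • x' i := fun i => by
        conv_lhs => rw [hx' i]
        rw [smul_add, Finset.smul_sum, smul_comm π]
        simp_rw [smul_smul]
      simp_rw [h1]
      rw [Finset.sum_add_distrib, Finset.sum_comm]
      simp_rw [← Finset.sum_smul, hd, smul_smul]
    obtain ⟨r, e, t, he, hfe⟩ := ih.exists_of_fintype _ _ ⟨z, hsum⟩
    choose w hw using he
    refine flatMod_of_fintype (κ := Fin r ⊕ Fin k)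
      (fun i => Sum.elim (fun s => ∑ j, c i j * e (.inl j) s + π * e (.inr i) s)
        fun j => π ^ m * c i j)
      (Sum.elim t fun j => w (.inl j)) (fun i => ⟨w (.inr i), ?_⟩) ?_
    · conv_lhs => rw [hx' i]
      have h1 (j) : y j = ∑ s, e (.inl j) s • t s + π ^ m • w (.inl j) := hw (.inl j)
      have h2 : x' i = ∑ s, e (.inr i) s • t s + π ^ m • w (.inr i) := hw (.inr i)
      rw [h2, Fintype.sum_sum_type]
      conv_lhs => enter [1, 2, j]; rw [h1 j]
      simp only [Sum.elim_inl, Sum.elim_inr, add_smul, Finset.sum_add_distrib, smul_add,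
        Finset.smul_sum, Finset.sum_smul, smul_smul, ← pow_succ']
      rw [Finset.sum_comm]
      simp only [mul_comm]
      abel
    · rintro (s | j)
      · obtain ⟨b, hb⟩ := hfe s
        rw [Fintype.sum_sum_type] at hb
        simp only [Sum.elim_inl, Sum.elim_inr] at hb
        refine ⟨b, ?_⟩
        rw [pow_succ', mul_assoc, ← hb]
        simp only [Sum.elim_inl, mul_add, Finset.mul_sum, Finset.sum_add_distrib]
        rw [Finset.sum_comm]
        congr 1
        · refine Finset.sum_congr rfl fun j _ => ?_
          rw [← mul_assoc, ← hd, Finset.sum_mul]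
          exact Finset.sum_congr rfl fun i _ => by ring
        · exact Finset.sum_congr rfl fun i _ => by ring
      · refine ⟨d j, ?_⟩
        simp only [Sum.elim_inr]
        rw [pow_succ, mul_assoc, ← hd j, Finset.mul_sum]
        exact Finset.sum_congr rfl fun i _ => by ring

/-- Flatness modulo `π` can be tested on models `R` and `S` of `A / π` and `M / π`. -/
theorem flatMod_of_flat {B R S : Type*} [CommRing B] [CommRing R] [CommRing S] [Algebra A B]
    [Algebra R S] [Module.Flat R S] {π : A} (α : A →+* R) (β : B →+* S)
    (hα : Function.Surjective α) (hβ : Function.Surjective β)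
    (hαk : ∀ a, α a = 0 → π ∣ a) (hβk : ∀ b, β b = 0 → ∃ z, b = π • z) (hπ : α π = 0)
    (hαβ : ∀ a, β (algebraMap A B a) = algebraMap R S (α a)) : FlatMod π B := by
  have hsmul (a : A) (b : B) : β (a • b) = α a • β b := by
    rw [Algebra.smul_def, map_mul, hαβ, ← Algebra.smul_def]
  rintro l f x ⟨z, hz⟩
  have h0 : ∑ i, α (f i) • β (x i) = 0 := by
    simp_rw [← hsmul, ← map_sum, hz, hsmul, hπ, zero_smul]
  obtain ⟨k, a, y, h1, h2⟩ := Module.Flat.isTrivialRelation_of_sum_smul_eq_zero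
    (R := R) (M := S) (f := fun i => α (f i)) (x := fun i => β (x i)) h0
  choose a' ha' using fun i j => hα (a i j)
  choose y' hy' using fun j => hβ (y j)
  refine ⟨k, a', y', fun i => ?_, fun j => hαk _ ?_⟩
  · obtain ⟨z, hz⟩ := hβk (x i - ∑ j, a' i j • y' j) (by
      rw [map_sub, sub_eq_zero, map_sum]
      simp_rw [hsmul, ha', hy']
      exact h1 i)
    exact ⟨z, by rw [← hz]; abel⟩
  · rw [map_sum, ← h2 j]
    simp_rw [map_mul, ha']

theorem FlatMod.flat_quotient {q : A} (h : FlatMod q M) :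
    Module.Flat (A ⧸ Ideal.span {q}) (M ⧸ (Ideal.span {q} • ⊤ : Submodule A M)) := by
  have hmem (x : M) : x ∈ (Ideal.span {q} • ⊤ : Submodule A M) ↔ ∃ z, x = q • z := by
    rw [Submodule.ideal_span_singleton_smul, Submodule.mem_smul_pointwise_iff_exists]
    simp [eq_comm]
  refine .of_forall_isTrivialRelation fun {l f x} hfx => ?_
  choose f' hf' using fun i => Ideal.Quotient.mk_surjective (f i)
  choose x' hx' using fun i => Submodule.Quotient.mk_surjective _ (x i)
  have hsmul (a : A) (b : M) : (Ideal.Quotient.mk (Ideal.span {q}) a) •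
      (Submodule.Quotient.mk b : M ⧸ (Ideal.span {q} • ⊤ : Submodule A M)) =
      Submodule.Quotient.mk (a • b) := rfl
  have hsum {κ : Type} [Fintype κ] (g : κ → M) : (Submodule.Quotient.mk (∑ i, g i) :
      M ⧸ (Ideal.span {q} • ⊤ : Submodule A M)) = ∑ i, Submodule.Quotient.mk (g i) :=
    map_sum (Submodule.mkQ _) _ _
  obtain ⟨k, a, y, h1, h2⟩ := h l f' x' (by
    rw [← hmem, ← Submodule.Quotient.mk_eq_zero, hsum, ← hfx]
    refine Finset.sum_congr rfl fun i _ => ?_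
    rw [← hsmul, hf', hx'])
  refine ⟨k, fun i j => Ideal.Quotient.mk _ (a i j), fun j => Submodule.Quotient.mk (y j),
    fun i => ?_, fun j => ?_⟩
  · obtain ⟨z, hz⟩ := h1 i
    refine (hx' i).symm.trans (Eq.trans ?_ (hsum fun j => a i j • y j))
    rw [Submodule.Quotient.eq, hmem]
    exact ⟨z, by rw [hz]; abel⟩
  · simp_rw [← hf', ← map_mul, ← map_sum]
    exact Ideal.Quotient.eq_zero_iff_mem.2 (Ideal.mem_span_singleton.2 (h2 j))

/-- If `M` is flat modulo `q` and `Q` is killed by `q`, relations in `Q ⊗ M` are consequences of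
relations in `Q`. -/
theorem FlatMod.exists_of_sum_tmul_eq_zero {q : A} (h : FlatMod q M) {Q : Type*} [AddCommGroup Q]
    [Module A Q] (hQ : ∀ x : Q, q • x = 0) {l : ℕ} {v : Fin l → Q} {x : Fin l → M}
    (hvx : ∑ i, v i ⊗ₜ x i = (0 : Q ⊗[A] M)) :
    ∃ (k : ℕ) (a : Fin l → Fin k → A) (y : Fin k → M),
      (∀ i, ∃ z, x i = ∑ j, a i j • y j + q • z) ∧ ∀ j, ∑ i, a i j • v i = 0 := by
  let I := Ideal.span {q}
  have hI : Module.IsTorsionBySet A Q I := by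
    rw [Module.isTorsionBySet_span_singleton_iff]
    exact fun x => hQ x
  let _ := hI.module
  have : IsScalarTower A (A ⧸ I) Q := Module.IsTorsionBySet.isScalarTower hI
  have := h.flat_quotient
  let N := M ⧸ (I • ⊤ : Submodule A M)
  let g : Q ⊗[A] M →ₗ[A] Q ⊗[A ⧸ I] N :=
    TensorProduct.lift <| LinearMap.mk₂ A
      (fun (x : Q) (y : M) => x ⊗ₜ[A ⧸ I] (Submodule.Quotient.mk y : N))
      (fun _ _ _ => TensorProduct.add_tmul _ _ _)
      (fun c x y => by
        rw [← algebraMap_smul (A ⧸ I) c x, TensorProduct.smul_tmul', algebraMap_smul])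
      (fun x y y' => by rw [Submodule.Quotient.mk_add, TensorProduct.tmul_add])
      (fun c x y => by
        rw [Submodule.Quotient.mk_smul, ← algebraMap_smul (A ⧸ I) c (Submodule.Quotient.mk y : N),
          TensorProduct.tmul_smul, algebraMap_smul])
  have h0 : ∑ i, v i ⊗ₜ[A ⧸ I] (Submodule.Quotient.mk (x i) : N) = 0 := by
    rw [← map_zero g, ← hvx, map_sum]
    rfl
  obtain ⟨k, a, y, h1, h2⟩ :=
    TensorProduct.vanishesTrivially_of_sum_tmul_eq_zero_of_rTensor_injective (A ⧸ I)
    (Module.Flat.rTensor_preserves_injective_linearMap _ (Submodule.subtype_injective _)) h0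
  choose a' ha' using fun i j => Ideal.Quotient.mk_surjective (a i j)
  choose y' hy' using fun j => Submodule.Quotient.mk_surjective _ (y j)
  refine ⟨k, a', y', fun i => ?_, fun j => ?_⟩
  · have h3 : (Submodule.Quotient.mk (x i) : N) = Submodule.Quotient.mk (∑ j, a' i j • y' j) := by
      refine (h1 i).trans ((Finset.sum_congr rfl fun j _ => ?_).trans
        (map_sum (Submodule.mkQ (I • ⊤ : Submodule A M)) _ _).symm)
      rw [← ha', ← hy']
      rfl
    rw [Submodule.Quotient.eq, Submodule.ideal_span_singleton_smul,
      Submodule.mem_smul_pointwise_iff_exists] at h3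
    obtain ⟨z, -, hz⟩ := h3
    exact ⟨z, by rw [hz]; abel⟩
  · rw [← h2 j]
    refine Finset.sum_congr rfl fun i _ => ?_
    rw [← ha']
    exact (algebraMap_smul (A ⧸ I) (a' i j) (v i)).symm

end FlatMod

/-! ### Descent of submodules modulo an element -/

section Descent

variable {A : Type*} [CommRing A]

/-- The homomorphism `T / q T → C / q C` induced by `J : T → C` is bijective; here `q` is an
element of the base ring `A`, and acts on `C` through `T`. -/
structure BijectiveMod {T C : Type*} [CommRing T] [Algebra A T] [CommRing C] (q : A)
    (J : T →+* C) : Prop where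
  surj : ∀ c, ∃ t c', c = J t + J (algebraMap A T q) * c'
  inj : ∀ t c, J t = J (algebraMap A T q) * c → ∃ t', t = q • t'

/-- If `π` is regular on `C`, a homomorphism to `C` which is bijective modulo `π` is bijective
modulo every power of `π`. -/
theorem BijectiveMod.pow {T C : Type*} [CommRing T] [Algebra A T] [CommRing C] {π : A}
    {J : T →+* C} (h : BijectiveMod π J) (hC : ∀ c, J (algebraMap A T π) * c = 0 → c = 0) (m : ℕ) :
    BijectiveMod (π ^ m) J := by
  induction m with
  | zero => exact ⟨fun c => ⟨0, c, by simp⟩, fun t c _ => ⟨t, by simp⟩⟩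
  | succ m ih =>
    refine ⟨fun c => ?_, fun t c htc => ?_⟩
    · obtain ⟨t, c', rfl⟩ := h.surj c
      obtain ⟨t', c'', rfl⟩ := ih.surj c'
      refine ⟨t + algebraMap A T π * t', c'', ?_⟩
      simp only [map_add, map_mul, map_pow, pow_succ']
      ring
    · obtain ⟨t', rfl⟩ := h.inj t (J (algebraMap A T (π ^ m)) * c) (by
        rw [htc, pow_succ']; simp [mul_assoc])
      obtain ⟨t'', rfl⟩ := ih.inj t' c (by
        rw [← sub_eq_zero]
        apply hC
        rw [mul_sub, ← map_mul J, ← Algebra.smul_def, htc, pow_succ']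
        simp [mul_assoc])
      exact ⟨t'', by rw [smul_smul, pow_succ']⟩

variable {B B' : Type*} [CommRing B] [Algebra A B] [CommRing B'] [Algebra A B'] {n : ℕ}

/-- The map `(B ⊗ B') ^ n = B ⊗ B' ^ n → B ⊗ (B' ^ n / M')`, with the factors of the target
interchanged. -/
def tensorToQuotient (B : Type*) [CommRing B] [Algebra A B] (M' : Submodule B' (Fin n → B')) :
    (Fin n → B ⊗[A] B') →ₗ[A] ((Fin n → B') ⧸ M'.restrictScalars A) ⊗[A] B :=
  ∑ k, ((TensorProduct.comm A B _).toLinearMap ∘ₗ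
    ((M'.restrictScalars A).mkQ ∘ₗ LinearMap.single A (fun _ : Fin n => B') k).lTensor B) ∘ₗ
    LinearMap.proj k

theorem tensorToQuotient_tmul (M' : Submodule B' (Fin n → B')) (s : Fin n → B) (y : Fin n → B') :
    tensorToQuotient B M' (fun k => s k ⊗ₜ[A] y k) =
      ∑ k, (M'.restrictScalars A).mkQ (Pi.single k (y k)) ⊗ₜ s k := by
  simp [tensorToQuotient]

theorem tensorToQuotient_mul_tmul (M' : Submodule B' (Fin n → B')) (t : B ⊗[A] B')
    {y : Fin n → B'} (hy : y ∈ M') :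
    tensorToQuotient B M' (fun k => t * (1 ⊗ₜ[A] y k)) = 0 := by
  induction t with
  | zero => simpa using! map_zero (tensorToQuotient B M')
  | add t₁ t₂ h₁ h₂ =>
    have : (fun k => (t₁ + t₂) * (1 ⊗ₜ[A] y k)) =
        (fun k => t₁ * (1 ⊗ₜ[A] y k)) + fun k => t₂ * (1 ⊗ₜ[A] y k) := by
      ext k; simp [add_mul]
    rw [this, map_add, h₁, h₂, add_zero]
  | tmul s b =>
    simp only [Algebra.TensorProduct.tmul_mul_tmul, mul_one]
    rw [tensorToQuotient_tmul, ← TensorProduct.sum_tmul, ← map_sum, Finset.univ_sum_single]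
    have : (M'.restrictScalars A).mkQ (fun k => b * y k) = 0 := by
      rw [Submodule.mkQ_apply, Submodule.Quotient.mk_eq_zero]
      exact M'.smul_mem b hy
    rw [this, TensorProduct.zero_tmul]

/-- If `x` is a vector over `B` whose image over `C` lies in the submodule generated by `M'`, and
`B ⊗ B' → C` is bijective modulo `q`, then `x` vanishes in `B ⊗ (B' ^ n / M')`. -/
theorem sum_mkQ_single_tmul_eq_zero {C : Type*} [CommRing C] {q : A} {J : B ⊗[A] B' →+* C}
    (hJ : BijectiveMod q J) (M' : Submodule B' (Fin n → B')) (hM' : ∀ v : Fin n → B', q • v ∈ M')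
    {x : Fin n → B}
    (hx : (fun k => J (x k ⊗ₜ 1)) ∈
      Submodule.span C ((fun y : Fin n → B' => fun k => J (1 ⊗ₜ y k)) '' (M' : Set (Fin n → B')))) :
    ∑ k, (M'.restrictScalars A).mkQ (Pi.single k 1) ⊗ₜ[A] x k = 0 := by
  have key : ∀ w ∈ Submodule.span C
      ((fun y : Fin n → B' => fun k => J (1 ⊗ₜ y k)) '' (M' : Set (Fin n → B'))),
      ∃ τ : Fin n → B ⊗[A] B', (∀ t, tensorToQuotient B M' (fun k => t * τ k) = 0) ∧
        ∀ k, ∃ c, w k = J (τ k) + J (algebraMap A _ q) * c := by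
    intro w hw
    induction hw using Submodule.span_induction with
    | mem w hw =>
      obtain ⟨y, hy, rfl⟩ := hw
      exact ⟨fun k => 1 ⊗ₜ y k, fun t => tensorToQuotient_mul_tmul M' t hy,
        fun k => ⟨0, by simp⟩⟩
    | zero =>
      exact ⟨0, fun t => by simpa using! map_zero (tensorToQuotient B M'), fun k => ⟨0, by simp⟩⟩
    | add w₁ w₂ _ _ h₁ h₂ =>
      obtain ⟨τ₁, h₁, h₁'⟩ := h₁
      obtain ⟨τ₂, h₂, h₂'⟩ := h₂
      refine ⟨τ₁ + τ₂, fun t => ?_, fun k => ?_⟩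
      · have : (fun k => t * (τ₁ + τ₂) k) = (fun k => t * τ₁ k) + fun k => t * τ₂ k := by
          ext k; simp [mul_add]
        rw [this, map_add, h₁, h₂, add_zero]
      · obtain ⟨c₁, hc₁⟩ := h₁' k
        obtain ⟨c₂, hc₂⟩ := h₂' k
        refine ⟨c₁ + c₂, ?_⟩
        rw [Pi.add_apply, hc₁, hc₂, Pi.add_apply, map_add]
        ring
    | smul c w _ h =>
      obtain ⟨τ, h, h'⟩ := h
      obtain ⟨t, c', rfl⟩ := hJ.surj c
      refine ⟨fun k => t * τ k, fun t' => by simpa only [mul_assoc] using h (t' * t), fun k => ?_⟩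
      obtain ⟨d, hd⟩ := h' k
      refine ⟨J t * d + c' * (J (τ k) + J (algebraMap A _ q) * d), ?_⟩
      rw [Pi.smul_apply, smul_eq_mul, hd, map_mul]
      ring
  obtain ⟨τ, hτ, hτ'⟩ := key _ hx
  choose c hc using hτ'
  choose t ht using fun k => hJ.inj (x k ⊗ₜ 1 - τ k) (c k) (by rw [map_sub, hc]; ring)
  have hq (z : ((Fin n → B') ⧸ M'.restrictScalars A) ⊗[A] B) : q • z = 0 := by
    induction z with
    | zero => simp
    | add z₁ z₂ h₁ h₂ => rw [smul_add, h₁, h₂, add_zero]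
    | tmul z s =>
      obtain ⟨z, rfl⟩ := Submodule.mkQ_surjective _ z
      have hz : (M'.restrictScalars A).mkQ (q • z) = 0 :=
        (Submodule.Quotient.mk_eq_zero _).2 (hM' z)
      rw [TensorProduct.smul_tmul', ← map_smul, hz, TensorProduct.zero_tmul]
  rw [← tensorToQuotient_tmul M' x fun _ => 1]
  have : (fun k => x k ⊗ₜ[A] (1 : B')) = (fun k => 1 * τ k) + q • t := by
    ext k
    rw [Pi.add_apply, Pi.smul_apply, ← ht]
    ring
  rw [this, map_add, hτ, map_smul, hq, add_zero]

/-- Descent of submodules along a family `A → B'ᵢ`, in the form needed here: if `M ⊆ B ^ n` agrees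
with `M'ᵢ ⊆ B'ᵢ ^ n` after extension to `Cᵢ = B ⊗ B'ᵢ`, then `M` is contained in the submodule
generated by the vectors in `A ^ n` which lie in all the `M'ᵢ`. Everything is only assumed modulo
an element `q` which multiplies the free modules into the given submodules. -/
theorem mem_span_of_descent {q : A} (hB : FlatMod q B) {ι : Type*} [Finite ι] {B' C : ι → Type*}
    [∀ i, CommRing (B' i)] [∀ i, Algebra A (B' i)] [∀ i, CommRing (C i)]
    {J : ∀ i, B ⊗[A] B' i →+* C i} (hJ : ∀ i, BijectiveMod q (J i))
    (M' : ∀ i, Submodule (B' i) (Fin n → B' i)) (hM' : ∀ i (v : Fin n → B' i), q • v ∈ M' i)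
    {x : Fin n → B}
    (hx : ∀ i, (fun k => J i (x k ⊗ₜ 1)) ∈ Submodule.span (C i)
      ((fun y : Fin n → B' i => fun k => J i (1 ⊗ₜ y k)) '' (M' i : Set (Fin n → B' i)))) :
    x ∈ Submodule.span B ((fun u : Fin n → A => fun k => algebraMap A B (u k)) ''
      {u | ∀ i, (fun k => algebraMap A (B' i) (u k)) ∈ M' i}) := by
  classical
  have := Fintype.ofFinite ι
  let Q (i : ι) := (Fin n → B' i) ⧸ (M' i).restrictScalars A
  let v (k : Fin n) : ∀ i, Q i := fun i => ((M' i).restrictScalars A).mkQ (Pi.single k 1)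
  have hv : ∑ k, v k ⊗ₜ[A] x k = 0 := by
    have h1 (k) : v k ⊗ₜ[A] x k = ∑ i, (LinearMap.single A Q i).rTensor B (v k i ⊗ₜ[A] x k) := by
      simp_rw [LinearMap.rTensor_tmul, ← TensorProduct.sum_tmul, LinearMap.single_apply]
      rw [Finset.univ_sum_single]
    simp_rw [h1]
    rw [Finset.sum_comm]
    simp_rw [← map_sum]
    refine Finset.sum_eq_zero fun i _ => ?_
    have h2 := sum_mkQ_single_tmul_eq_zero (hJ i) (M' i) (hM' i) (hx i)
    exact (congrArg _ h2).trans (map_zero _)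
  have hQ (z : ∀ i, Q i) : q • z = 0 := by
    funext i
    obtain ⟨w, hw⟩ := Submodule.mkQ_surjective _ (z i)
    rw [Pi.smul_apply, ← hw, ← map_smul]
    exact (Submodule.Quotient.mk_eq_zero _).2 (hM' i w)
  obtain ⟨k, a, y, h1, h2⟩ := hB.exists_of_sum_tmul_eq_zero hQ hv
  choose z hz using h1
  have hxe : x = ∑ j, y j • (fun i => algebraMap A B (a i j)) +
      ∑ i, z i • (fun l => algebraMap A B ((Pi.single i q : Fin n → A) l)) := by
    funext i
    rw [hz i]
    simp [Algebra.smul_def, mul_comm, Pi.single_apply, apply_ite (algebraMap A B)]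
  rw [hxe]
  refine Submodule.add_mem _ (Submodule.sum_mem _ fun j _ => Submodule.smul_mem _ _
    (Submodule.subset_span ⟨fun i => a i j, fun i => ?_, rfl⟩))
    (Submodule.sum_mem _ fun l _ => Submodule.smul_mem _ _
    (Submodule.subset_span ⟨Pi.single l q, fun i => ?_, rfl⟩))
  · have h3 := congrFun (h2 j) i
    have h4 : ((M' i).restrictScalars A).mkQ (fun k => algebraMap A (B' i) (a k j)) = 0 := by
      refine Eq.trans ?_ h3
      simp only [Finset.sum_apply, Pi.smul_apply]
      change _ = ∑ l, a l j • ((M' i).restrictScalars A).mkQ (Pi.single l 1)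
      simp_rw [← map_smul, ← map_sum]
      congr 1
      rw [← Finset.univ_sum_single (fun k => algebraMap A (B' i) (a k j))]
      refine Finset.sum_congr rfl fun l _ => ?_
      rw [← Pi.single_smul, Algebra.smul_def, mul_one]
    exact (Submodule.Quotient.mk_eq_zero _).1 h4
  · convert hM' i (Pi.single l 1) using 1
    funext k
    rcases eq_or_ne k l with rfl | h <;> simp [Algebra.smul_def, *]

end Descent

/-! ### Tensor products of perfect rings and of Witt vectors -/

section Tensor

/-- The universal property of the tensor product of `R`-algebras, with values in a mere ring. -/
theorem exists_ringHom_tensorProduct {R S S' E : Type*} [CommRing R] [CommRing S] [CommRing S']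
    [CommRing E] [Algebra R S] [Algebra R S'] (b : S →+* E) (b' : S' →+* E)
    (h : ∀ r, b (algebraMap R S r) = b' (algebraMap R S' r)) :
    ∃ ψ : S ⊗[R] S' →+* E, ∀ s s', ψ (s ⊗ₜ s') = b s * b' s' := by
  let _ : Algebra R E := (b.comp (algebraMap R S)).toAlgebra
  let f : S →ₐ[R] E := { b with commutes' := fun _ => rfl }
  let f' : S' →ₐ[R] E := { b' with commutes' := fun r => (h r).symm }
  exact ⟨(Algebra.TensorProduct.productMap f f').toRingHom,
    fun s s' => Algebra.TensorProduct.productMap_apply_tmul f f' s s'⟩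

/-- The tensor product of perfect rings over a perfect ring is perfect: the inverses of the
Frobenius maps induce an inverse of the Frobenius of the tensor product. -/
theorem perfectRing_tensorProduct {p : ℕ} [Fact p.Prime] {R S S' : Type u} [CommRing R] [CommRing S]
    [CommRing S'] [Algebra R S] [Algebra R S'] [PerfectRing R p] [PerfectRing S p]
    [PerfectRing S' p] (hp : (p : R) = 0) : PerfectRing (S ⊗[R] S') p := by
  rcases subsingleton_or_nontrivial (S ⊗[R] S') with hT | hT
  · exact ⟨⟨fun _ _ _ => Subsingleton.elim _ _, fun _ => ⟨0, Subsingleton.elim _ _⟩⟩⟩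
  let i : S →+* S ⊗[R] S' := Algebra.TensorProduct.includeLeftRingHom
  let i' : S' →+* S ⊗[R] S' := (Algebra.TensorProduct.includeRight : S' →ₐ[R] S ⊗[R] S').toRingHom
  have hpT {T : Type u} [CommRing T] [Algebra R T] : (p : T) = 0 := by
    rw [← map_natCast (algebraMap R T), hp, map_zero]
  have : Nontrivial S := i.domain_nontrivial
  have : Nontrivial S' := i'.domain_nontrivial
  have : Nontrivial R := (algebraMap R S).domain_nontrivial
  have : CharP R p := charP_of_natCast_eq_zero hp
  have : CharP S p := charP_of_natCast_eq_zero hpT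
  have : CharP S' p := charP_of_natCast_eq_zero hpT
  have : CharP (S ⊗[R] S') p := charP_of_natCast_eq_zero hpT
  obtain ⟨ψ, hψ⟩ := exists_ringHom_tensorProduct (R := R)
    (i.comp (frobeniusEquiv S p).symm.toRingHom) (i'.comp (frobeniusEquiv S' p).symm.toRingHom)
    (fun r => by
      change i ((frobeniusEquiv S p).symm _) = i' ((frobeniusEquiv S' p).symm _)
      rw [← RingHom.map_frobeniusEquiv_symm, ← RingHom.map_frobeniusEquiv_symm]
      exact Algebra.TensorProduct.algebraMap_apply' _)
  have hψ' (s : S) (s' : S') : ψ (s ⊗ₜ s') =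
      (frobeniusEquiv S p).symm s ⊗ₜ (frobeniusEquiv S' p).symm s' := by
    rw [hψ]
    change ((frobeniusEquiv S p).symm s ⊗ₜ[R] (1 : S')) * ((1 : S) ⊗ₜ[R] _) = _
    rw [Algebra.TensorProduct.tmul_mul_tmul, mul_one, one_mul]
    rfl
  have h1 (t : S ⊗[R] S') : ψ (t ^ p) = t := by
    induction t with
    | zero => rw [zero_pow (Fact.out : p.Prime).ne_zero, map_zero]
    | add x y hx hy => rw [add_pow_char, map_add, hx, hy]
    | tmul s s' =>
      rw [Algebra.TensorProduct.tmul_pow, hψ', frobeniusEquiv_symm_pow, frobeniusEquiv_symm_pow]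
  have h2 (t : S ⊗[R] S') : ψ t ^ p = t := by
    rw [← map_pow, h1]
  exact ⟨⟨Function.LeftInverse.injective h1, fun t => ⟨ψ t, h2 t⟩⟩⟩

/-- The kernel of `B ⊗ B' → S ⊗ S'` is generated by `q` if this holds for `B → S` and `B' → S'`. -/
theorem exists_eq_smul_of_tensorProduct_map_eq_zero {A B B' R S S' : Type*} [CommRing A]
    [CommRing B] [CommRing B'] [CommRing R] [CommRing S] [CommRing S'] [Algebra A B] [Algebra A B']
    [Algebra R S] [Algebra R S'] {q : A} {α : A →+* R} {β : B →+* S} {β' : B' →+* S'}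
    (hα : Function.Surjective α) (hβ : Function.Surjective β) (hβ' : Function.Surjective β')
    (hαβ : ∀ a, β (algebraMap A B a) = algebraMap R S (α a))
    (hαβ' : ∀ a, β' (algebraMap A B' a) = algebraMap R S' (α a))
    (hk : ∀ b, β b = 0 → ∃ z, b = q • z) (hk' : ∀ b, β' b = 0 → ∃ z, b = q • z)
    {ρ : B ⊗[A] B' →+* S ⊗[R] S'} (hρ : ∀ b b', ρ (b ⊗ₜ b') = β b ⊗ₜ β' b')
    {t : B ⊗[A] B'} (ht : ρ t = 0) : ∃ t', t = q • t' := by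
  let I : Ideal (B ⊗[A] B') := Ideal.span {algebraMap A _ q}
  have hI (z : B ⊗[A] B') : q • z ∈ I := by
    rw [Algebra.smul_def]
    exact I.mul_mem_right _ (Ideal.mem_span_singleton_self _)
  let i : B →+* B ⊗[A] B' ⧸ I := (Ideal.Quotient.mk I).comp Algebra.TensorProduct.includeLeftRingHom
  let i' : B' →+* B ⊗[A] B' ⧸ I := (Ideal.Quotient.mk I).comp
    (Algebra.TensorProduct.includeRight : B' →ₐ[A] B ⊗[A] B').toRingHom
  have hi : RingHom.ker β ≤ RingHom.ker i := fun b hb => by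
    obtain ⟨z, rfl⟩ := hk b hb
    refine Ideal.Quotient.eq_zero_iff_mem.2 ?_
    change (q • z) ⊗ₜ[A] (1 : B') ∈ I
    rw [← TensorProduct.smul_tmul']
    exact hI _
  have hi' : RingHom.ker β' ≤ RingHom.ker i' := fun b hb => by
    obtain ⟨z, rfl⟩ := hk' b hb
    refine Ideal.Quotient.eq_zero_iff_mem.2 ?_
    change (1 : B) ⊗ₜ[A] (q • z) ∈ I
    rw [TensorProduct.tmul_smul]
    exact hI _
  let j := RingHom.liftOfSurjective β hβ ⟨i, hi⟩
  let j' := RingHom.liftOfSurjective β' hβ' ⟨i', hi'⟩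
  have hj (b) : j (β b) = i b := RingHom.liftOfRightInverse_comp_apply β _ _ ⟨i, hi⟩ b
  have hj' (b) : j' (β' b) = i' b := RingHom.liftOfRightInverse_comp_apply β' _ _ ⟨i', hi'⟩ b
  obtain ⟨ψ, hψ⟩ := exists_ringHom_tensorProduct (R := R) j j' fun r => by
    obtain ⟨a, rfl⟩ := hα r
    rw [← hαβ, ← hαβ', hj, hj']
    exact congrArg (Ideal.Quotient.mk I) (Algebra.TensorProduct.algebraMap_apply' _)
  have hcomp (t : B ⊗[A] B') : ψ (ρ t) = Ideal.Quotient.mk I t := by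
    induction t with
    | zero => simp
    | add x y hx hy => rw [map_add, map_add, hx, hy, map_add]
    | tmul b b' =>
      rw [hρ, hψ, hj, hj']
      change Ideal.Quotient.mk I (b ⊗ₜ[A] (1 : B')) * Ideal.Quotient.mk I ((1 : B) ⊗ₜ[A] b') = _
      rw [← map_mul, Algebra.TensorProduct.tmul_mul_tmul, mul_one, one_mul]
  have h0 : t ∈ I := Ideal.Quotient.eq_zero_iff_mem.1 (by rw [← hcomp, ht, map_zero])
  obtain ⟨t', rfl⟩ := Ideal.mem_span_singleton.1 h0
  exact ⟨t', (Algebra.smul_def _ _).symm⟩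

end Tensor

section WittTensor

variable {p : ℕ} [Fact p.Prime] {R S S' : Type u} [CommRing R] [CommRing S] [CommRing S']
  [Algebra R S] [Algebra R S']

/-- For an `R`-algebra `S`, the ring `W(S)` as a `W(R)`-algebra. -/
abbrev wittAlgebra (p : ℕ) [Fact p.Prime] (R S : Type u) [CommRing R] [CommRing S] [Algebra R S] :
    Algebra (WittVector p R) (WittVector p S) :=
  (WittVector.map (algebraMap R S)).toAlgebra

attribute [local instance] wittAlgebra

theorem witt_exists_eq_smul [PerfectRing S p] (hp : (p : S) = 0) (b : WittVector p S)
    (hb : WittVector.constantCoeff b = 0) : ∃ z, b = (p : WittVector p R) • z := by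
  obtain ⟨z, rfl⟩ := (witt_dvd_iff hp b).2 hb
  exact ⟨z, by rw [Algebra.smul_def, map_natCast]⟩

/-- If `S` is flat over `R`, then `W(S)` is flat over `W(R)` modulo every power of `p`. -/
theorem flatMod_witt [PerfectRing R p] [PerfectRing S p] [Module.Flat R S] (hp : (p : R) = 0)
    (m : ℕ) : FlatMod ((p : WittVector p R) ^ m) (WittVector p S) := by
  have hpS : (p : S) = 0 := by rw [← map_natCast (algebraMap R S), hp, map_zero]
  refine FlatMod.pow (flatMod_of_flat (R := R) (S := S) WittVector.constantCoeff
    WittVector.constantCoeff (WittVector.constantCoeff_surjective p)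
    (WittVector.constantCoeff_surjective p) (fun a => (witt_dvd_iff hp a).2)
    (witt_exists_eq_smul hpS) ((witt_dvd_iff hp _).1 dvd_rfl) fun a => WittVector.map_coeff _ _ _)
    (fun x hx => witt_eq_zero_of_p_mul hpS x ?_) m
  rwa [Algebra.smul_def, map_natCast] at hx

variable (p R S S') in
/-- The natural homomorphism `W(S) ⊗ W(S') → W(S ⊗ S')`. -/
def wittTensorMap : WittVector p S ⊗[WittVector p R] WittVector p S' →+* WittVector p (S ⊗[R] S') :=
  (Algebra.TensorProduct.productMap
    ({ WittVector.map (Algebra.TensorProduct.includeLeftRingHom : S →+* S ⊗[R] S') with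
        commutes' := fun a => by
          ext i
          exact (WittVector.map_coeff _ _ _).trans (by
            rw [RingHom.algebraMap_toAlgebra, RingHom.algebraMap_toAlgebra, WittVector.map_coeff,
              WittVector.map_coeff]
            rfl) } : WittVector p S →ₐ[WittVector p R] WittVector p (S ⊗[R] S'))
    ({ WittVector.map (Algebra.TensorProduct.includeRight : S' →ₐ[R] S ⊗[R] S').toRingHom with
        commutes' := fun a => by
          ext i
          exact (WittVector.map_coeff _ _ _).trans (by
            rw [RingHom.algebraMap_toAlgebra, RingHom.algebraMap_toAlgebra, WittVector.map_coeff,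
              WittVector.map_coeff]
            exact AlgHom.commutes _ _) } :
      WittVector p S' →ₐ[WittVector p R] WittVector p (S ⊗[R] S'))).toRingHom

theorem wittTensorMap_tmul (x : WittVector p S) (y : WittVector p S') :
    wittTensorMap p R S S' (x ⊗ₜ y) =
      WittVector.map (Algebra.TensorProduct.includeLeftRingHom : S →+* S ⊗[R] S') x *
      WittVector.map (Algebra.TensorProduct.includeRight : S' →ₐ[R] S ⊗[R] S').toRingHom y :=
  Algebra.TensorProduct.productMap_apply_tmul _ _ x y

theorem constantCoeff_wittTensorMap_tmul (x : WittVector p S) (y : WittVector p S') :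
    WittVector.constantCoeff (wittTensorMap p R S S' (x ⊗ₜ y)) =
      WittVector.constantCoeff x ⊗ₜ WittVector.constantCoeff y := by
  rw [wittTensorMap_tmul, map_mul]
  change (WittVector.map (Algebra.TensorProduct.includeLeftRingHom : S →+* S ⊗[R] S') x).coeff 0 *
    (WittVector.map (Algebra.TensorProduct.includeRight : S' →ₐ[R] S ⊗[R] S').toRingHom y).coeff 0
      = _
  rw [WittVector.map_coeff, WittVector.map_coeff]
  change (x.coeff 0 ⊗ₜ[R] (1 : S')) * ((1 : S) ⊗ₜ[R] y.coeff 0) = _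
  rw [Algebra.TensorProduct.tmul_mul_tmul, mul_one, one_mul]
  rfl

/-- For perfect rings, `W(S) ⊗ W(S') → W(S ⊗ S')` is bijective modulo every power of `p`. -/
theorem bijectiveMod_wittTensorMap [PerfectRing R p] [PerfectRing S p] [PerfectRing S' p]
    (hp : (p : R) = 0) (m : ℕ) :
    BijectiveMod ((p : WittVector p R) ^ m) (wittTensorMap p R S S') := by
  have hpT {T : Type u} [CommRing T] [Algebra R T] : (p : T) = 0 := by
    rw [← map_natCast (algebraMap R T), hp, map_zero]
  have := perfectRing_tensorProduct (p := p) (S := S) (S' := S') hp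
  refine BijectiveMod.pow ⟨fun c => ?_, fun t c htc => ?_⟩ (fun c hc => ?_) m
  · have h : ∃ t, WittVector.constantCoeff (wittTensorMap p R S S' t) =
        WittVector.constantCoeff c := by
      induction WittVector.constantCoeff c with
      | zero => exact ⟨0, by simp⟩
      | add x y hx hy =>
        obtain ⟨t, ht⟩ := hx
        obtain ⟨t', ht'⟩ := hy
        exact ⟨t + t', by rw [map_add, map_add, ht, ht']⟩
      | tmul s s' =>
        obtain ⟨x, rfl⟩ := WittVector.constantCoeff_surjective p s
        obtain ⟨y, rfl⟩ := WittVector.constantCoeff_surjective p s'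
        exact ⟨_, constantCoeff_wittTensorMap_tmul x y⟩
    obtain ⟨t, ht⟩ := h
    obtain ⟨c', hc'⟩ := (witt_dvd_iff hpT (c - wittTensorMap p R S S' t)).2 (by
      rw [map_sub, ht, sub_self])
    exact ⟨t, c', by rw [map_natCast, map_natCast, ← hc']; ring⟩
  · refine exists_eq_smul_of_tensorProduct_map_eq_zero
      (ρ := WittVector.constantCoeff.comp (wittTensorMap p R S S'))
      (WittVector.constantCoeff_surjective p)
      (WittVector.constantCoeff_surjective p) (WittVector.constantCoeff_surjective p)
      (fun a => WittVector.map_coeff _ _ _) (fun a => WittVector.map_coeff _ _ _)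
      (witt_exists_eq_smul hpT) (witt_exists_eq_smul hpT) constantCoeff_wittTensorMap_tmul ?_
    rw [RingHom.comp_apply, htc, map_natCast, map_natCast, map_mul, map_natCast, hpT, zero_mul]
  · rw [map_natCast, map_natCast] at hc
    exact witt_eq_zero_of_p_mul hpT c hc

end WittTensor

/-! ### Faithfully flat descent of special lattices -/

section LatticeDescent

variable {p : ℕ} [Fact p.Prime] {n : ℕ}

/-- A family of homomorphisms is jointly surjective on spectra. -/
def JointlySurjective {R : Type*} [CommRing R] {ι : Type*} {S : ι → Type*} [∀ i, CommRing (S i)]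
    (f : ∀ i, R →+* S i) : Prop :=
  ∀ x : PrimeSpectrum R, ∃ i y, PrimeSpectrum.comap (f i) y = x

/-- A faithfully flat family of homomorphisms is jointly injective. -/
theorem JointlySurjective.eq_zero {R : Type*} [CommRing R] {ι : Type*} {S : ι → Type*}
    [∀ i, CommRing (S i)] {f : ∀ i, R →+* S i} (hf : JointlySurjective f)
    (hflat : ∀ i, (f i).Flat) {r : R} (hr : ∀ i, f i r = 0) : r = 0 := by
  -- by flatness, the annihilator of `r` generates the unit ideal in every `S i`
  by_contra h0
  let I : Ideal R := LinearMap.ker (LinearMap.toSpanSingleton R R r)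
  have hI : I ≠ ⊤ := fun h => h0 <| by
    have : (1 : R) ∈ I := h ▸ trivial
    simpa [I] using this
  obtain ⟨m, hm, hIm⟩ := I.exists_le_maximal hI
  obtain ⟨i, y, hy⟩ := hf ⟨m, hm.isPrime⟩
  let _ := (f i).toAlgebra
  have : Module.Flat R (S i) := hflat i
  obtain ⟨k, a, z, h1, h2⟩ := Module.Flat.isTrivialRelation_of_sum_smul_eq_zero
    (R := R) (M := S i) (ι := Unit) (f := fun _ => r) (x := fun _ => 1)
    (by
      simpa only [Finset.univ_unique, Finset.sum_singleton, Algebra.smul_def, mul_one] using! hr i)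
  apply y.isPrime.one_notMem
  have h1' : (1 : S i) = ∑ j, a () j • z j := h1 ()
  rw [h1']
  refine Ideal.sum_mem _ fun j _ => ?_
  rw [Algebra.smul_def]
  refine y.asIdeal.mul_mem_right _ ?_
  have h3 : a () j ∈ m := hIm (by simpa [I, mul_comm] using h2 j)
  have h4 : (PrimeSpectrum.comap (f i) y).asIdeal = m := congrArg PrimeSpectrum.asIdeal hy
  rw [← h4] at h3
  exact h3

section

variable {R : Type u} [CommRing R] [PerfectRing R p] {ι : Type*} {S : ι → Type u}
  [∀ i, CommRing (S i)] [∀ i, PerfectRing (S i) p]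

/-- The vector over `K'` obtained by applying `φ` to all entries. -/
abbrev mapVec {K K' : Type*} [CommRing K] [CommRing K'] (φ : K →+* K') (v : Fin n → K) :
    Fin n → K' :=
  fun k => φ (v k)

theorem det_update_mapVec {K K' : Type*} [CommRing K] [CommRing K'] (φ : K →+* K')
    (v : Fin n → Fin n → K) (i : Fin n) (w : Fin n → K) :
    Matrix.det (Function.update (fun j => mapVec φ (v j)) i (mapVec φ w)) =
      φ (Matrix.det (Function.update v i w)) := by
  refine Eq.trans (congrArg Matrix.det ?_) (RingHom.map_det φ _).symm
  funext j l
  change _ = φ (Function.update v i w j l)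
  rcases eq_or_ne j i with rfl | h
  · rw [Function.update_self, Function.update_self]
  · rw [Function.update_of_ne h, Function.update_of_ne h]

/-- A vector belongs to a special lattice as soon as this holds after a jointly injective family of
base changes. -/
theorem IsSpecialLattice.mem_of_forall (hp : (p : R) = 0) (hS : ∀ i, (p : S i) = 0)
    {f : ∀ i, R →+* S i} (hf : ∀ r, (∀ i, f i r = 0) → r = 0)
    {L : Submodule (WittVector p R) (Fin n → WittLoc p R)} (hL : IsSpecialLattice L)
    {w : Fin n → WittLoc p R} (hw : ∀ i, mapVec (wittLocMap p (f i)) w ∈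
      extendLattice (WittVector p (S i)) (wittLocMap p (f i)) L) : w ∈ L := by
  refine mem_of_det_update_mem hL.one_mem_span fun v hv j => ?_
  refine Submodule.mem_one.2 (mem_range_algebraMap_of_forall hp hS f hf _ fun i => ?_)
  have hLi := isSpecialLattice_extendLattice (WittVector.map (f i)) _ (wittLocMap_algebraMap p _)
    (algebraMap_wittLoc_injective p (hS i)) hL
  rw [← det_update_mapVec]
  refine Submodule.mem_one.1 (hLi.det_mem fun l => ?_)
  rcases eq_or_ne l j with rfl | h
  · rw [Function.update_self]; exact hw i
  · rw [Function.update_of_ne h]; exact Submodule.subset_span ⟨_, hv l, rfl⟩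

/-- Special lattices agree as soon as they agree after a jointly injective family of base
changes. -/
theorem IsSpecialLattice.eq_of_forall (hp : (p : R) = 0) (hS : ∀ i, (p : S i) = 0)
    {f : ∀ i, R →+* S i} (hf : ∀ r, (∀ i, f i r = 0) → r = 0)
    {L L' : Submodule (WittVector p R) (Fin n → WittLoc p R)} (hL : IsSpecialLattice L)
    (hL' : IsSpecialLattice L')
    (h : ∀ i, extendLattice (WittVector p (S i)) (wittLocMap p (f i)) L =
      extendLattice (WittVector p (S i)) (wittLocMap p (f i)) L') : L = L' := by
  refine le_antisymm (fun w hw => hL'.mem_of_forall hp hS hf fun i => ?_)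
    (fun w hw => hL.mem_of_forall hp hS hf fun i => ?_)
  · rw [← h i]; exact Submodule.subset_span ⟨w, hw, rfl⟩
  · rw [h i]; exact Submodule.subset_span ⟨w, hw, rfl⟩

end

section Scaled

variable {R S : Type u} [CommRing R] [CommRing S]

/-- The map `u ↦ p ^ (-N) u` from `W(R) ^ n` to `W(R)[1/p] ^ n`. As `p` is a unit of `W(R)[1/p]`,
its inverse is given by `Ring.inverse`. -/
def scaledEmbedding (p : ℕ) [Fact p.Prime] (R : Type u) [CommRing R] (n N : ℕ) :
    (Fin n → WittVector p R) →ₗ[WittVector p R] (Fin n → WittLoc p R) :=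
  LinearMap.pi fun k => (LinearMap.mulLeft _ (Ring.inverse (p : WittLoc p R) ^ N)) ∘ₗ
    Algebra.linearMap _ _ ∘ₗ LinearMap.proj k

theorem scaledEmbedding_apply (N : ℕ) (u : Fin n → WittVector p R) (k : Fin n) :
    scaledEmbedding p R n N u k = Ring.inverse (p : WittLoc p R) ^ N * algebraMap _ _ (u k) := rfl

theorem pow_mul_scaledEmbedding (N : ℕ) (u : Fin n → WittVector p R) (k : Fin n) :
    (p : WittLoc p R) ^ N * scaledEmbedding p R n N u k = algebraMap _ _ (u k) := by
  rw [scaledEmbedding_apply, ← mul_assoc, ← mul_pow, Ring.mul_inverse_cancel _ isUnit_p_wittLoc,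
    one_pow, one_mul]

theorem mapVec_scaledEmbedding (f : R →+* S) (N : ℕ) (u : Fin n → WittVector p R) :
    mapVec (wittLocMap p f) (scaledEmbedding p R n N u) =
      scaledEmbedding p S n N (mapVec (WittVector.map f) u) := by
  funext k
  refine ((isUnit_p_wittLoc (p := p) (R := S)).pow N).mul_left_cancel ?_
  rw [pow_mul_scaledEmbedding, ← wittLocMap_algebraMap, ← pow_mul_scaledEmbedding N u k, map_mul,
    map_pow, map_natCast]

theorem scaledEmbedding_injective [PerfectRing R p] (hp : (p : R) = 0) (N : ℕ) :
    Function.Injective (scaledEmbedding p R n N) := by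
  intro u v h
  funext k
  apply algebraMap_wittLoc_injective p hp
  rw [← pow_mul_scaledEmbedding N u k, h, pow_mul_scaledEmbedding]

/-- A lattice lies between `p ^ N W(R) ^ n` and `p ^ (-N) W(R) ^ n` for large `N`. -/
theorem IsLattice.exists_bound {L : Submodule (WittVector p R) (Fin n → WittLoc p R)}
    (hL : IsLattice L) : ∃ N₀, ∀ N ≥ N₀, L ≤ LinearMap.range (scaledEmbedding p R n N) ∧
      ∀ u : Fin n → WittVector p R,
        scaledEmbedding p R n N ((p : WittVector p R) ^ (2 * N) • u) ∈ L := by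
  have h1 : ∃ N₀, ∀ N ≥ N₀, L ≤ LinearMap.range (scaledEmbedding p R n N) := by
    obtain ⟨s, hs⟩ := hL.fg
    have h (w : Fin n → WittLoc p R) :
        ∃ N₀, ∀ N ≥ N₀, w ∈ LinearMap.range (scaledEmbedding p R n N) := by
      choose M a ha using fun k => exists_pow_mul_eq_algebraMap (w k)
      refine ⟨∑ k, M k, fun N hN => ⟨fun k => (p : WittVector p R) ^ (N - M k) * a k, ?_⟩⟩
      funext k
      have hk : M k ≤ N :=
        (Finset.single_le_sum (fun _ _ => Nat.zero_le _) (Finset.mem_univ k)).trans hN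
      refine ((isUnit_p_wittLoc (p := p) (R := R)).pow N).mul_left_cancel ?_
      rw [pow_mul_scaledEmbedding, map_mul, ← ha, map_pow, map_natCast, ← mul_assoc, ← pow_add,
        Nat.sub_add_cancel hk]
    choose M hM using h
    refine ⟨∑ w ∈ s, M w, fun N hN => ?_⟩
    rw [← hs]
    refine Submodule.span_le.2 fun w hw => hM w N ?_
    exact (Finset.single_le_sum (f := M) (fun _ _ => Nat.zero_le _) hw).trans hN
  have h2 : ∃ N₀, ∀ N ≥ N₀, ∀ u : Fin n → WittVector p R,
      scaledEmbedding p R n N ((p : WittVector p R) ^ (2 * N) • u) ∈ L := by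
    have hloc := (isLocalizedModule_iff_isBaseChange (Submonoid.powers (p : WittVector p R))
      (WittLoc p R) L.subtype).2 hL.isBaseChange
    have h (k : Fin n) : ∃ M : ℕ,
        (p : WittVector p R) ^ M • (Pi.single k 1 : Fin n → WittLoc p R) ∈ L := by
      obtain ⟨⟨x, ⟨_, M, rfl⟩⟩, hx⟩ := hloc.surj (Pi.single k 1)
      exact ⟨M, by have := x.2; rwa [show (x : Fin n → WittLoc p R) = _ from hx.symm] at this⟩
    choose M hM using h
    refine ⟨∑ k, M k, fun N hN u => ?_⟩
    have : scaledEmbedding p R n N ((p : WittVector p R) ^ (2 * N) • u) =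
        ∑ k, (u k * (p : WittVector p R) ^ (N - M k)) •
          (p : WittVector p R) ^ M k • (Pi.single k 1 : Fin n → WittLoc p R) := by
      funext k
      refine ((isUnit_p_wittLoc (p := p) (R := R)).pow N).mul_left_cancel ?_
      have hk : M k ≤ N :=
        (Finset.single_le_sum (fun _ _ => Nat.zero_le _) (Finset.mem_univ k)).trans hN
      rw [pow_mul_scaledEmbedding, Finset.sum_apply, Finset.sum_eq_single k]
      · rw [smul_smul, mul_assoc, ← pow_add, Nat.sub_add_cancel hk]
        simp [Algebra.smul_def, two_mul, pow_add]
        ring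
      · intro j _ hj
        simp [Pi.single_eq_of_ne hj.symm]
      · simp
    rw [this]
    exact Submodule.sum_mem _ fun k _ => Submodule.smul_mem _ _ (hM k)
  obtain ⟨N₁, h1⟩ := h1
  obtain ⟨N₂, h2⟩ := h2
  exact ⟨max N₁ N₂, fun N hN => ⟨h1 N (le_of_max_le_left hN), h2 N (le_of_max_le_right hN)⟩⟩

end Scaled

attribute [local instance] wittAlgebra

variable {R : Type u} [CommRing R] [PerfectRing R p] {ι : Type*} {S : ι → Type u}
  [∀ i, CommRing (S i)] [∀ i, PerfectRing (S i) p] [∀ i, Algebra R (S i)]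

/-- The vectors over `W(R)[1/p]` which lie in the given lattices after base change. -/
def descendedLattice (L : ∀ i, Submodule (WittVector p (S i)) (Fin n → WittLoc p (S i))) :
    Submodule (WittVector p R) (Fin n → WittLoc p R) where
  carrier := {v | ∀ i, mapVec (wittLocMap p (algebraMap R (S i))) v ∈ L i}
  add_mem' {v w} hv hw i := by
    convert (L i).add_mem (hv i) (hw i) using 1
    funext k; exact map_add _ _ _
  zero_mem' i := by
    convert (L i).zero_mem using 1
    funext k; exact map_zero _
  smul_mem' c v hv i := by
    convert (L i).smul_mem (WittVector.map (algebraMap R (S i)) c) (hv i) using 1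
    funext k
    change wittLocMap p (algebraMap R (S i)) (c • v k) =
      WittVector.map (algebraMap R (S i)) c • wittLocMap p (algebraMap R (S i)) (v k)
    rw [Algebra.smul_def, map_mul, wittLocMap_algebraMap, ← Algebra.smul_def]

/-- Effectivity of descent for lattices. The rings `W(Sᵢ)` need not be flat over `W(R)`, and
`W(Sᵢ) ⊗ W(Sⱼ)` need not be `W(Sᵢ ⊗ Sⱼ)`, but both hold modulo powers of `p`, which is enough for
`mem_span_of_descent` because lattices contain a power of `p`. -/
theorem extendLattice_descendedLattice [Finite ι] [∀ i, Module.Flat R (S i)] (hp : (p : R) = 0)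
    {L : ∀ i, Submodule (WittVector p (S i)) (Fin n → WittLoc p (S i))}
    (hL : ∀ i, IsLattice (L i))
    (hglue : ∀ i j, extendLattice (WittVector p (S i ⊗[R] S j))
        (wittLocMap p (Algebra.TensorProduct.includeLeftRingHom : S i →+* S i ⊗[R] S j)) (L i) =
      extendLattice (WittVector p (S i ⊗[R] S j))
        (wittLocMap p (Algebra.TensorProduct.includeRight : S j →ₐ[R] S i ⊗[R] S j).toRingHom)
          (L j))
    (i : ι) :
    extendLattice (WittVector p (S i)) (wittLocMap p (algebraMap R (S i))) (descendedLattice L) =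
      L i := by
  have hpT {T : Type u} [CommRing T] [Algebra R T] : (p : T) = 0 := by
    rw [← map_natCast (algebraMap R T), hp, map_zero]
  have hperf (j : ι) : PerfectRing (S i ⊗[R] S j) p := perfectRing_tensorProduct hp
  refine le_antisymm (Submodule.span_le.2 ?_) fun x hx => ?_
  · rintro _ ⟨v, hv, rfl⟩
    exact hv i
  have := Fintype.ofFinite ι
  -- choose `N` such that all lattices lie between `p ^ N W ^ n` and `p ^ (-N) W ^ n`, and multiply
  -- them by `p ^ N`; they then contain `p ^ (2 * N) W ^ n`
  choose N₀ hN₀ using fun j => (hL j).exists_bound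
  let N := ∑ j, N₀ j
  have hN (j : ι) := hN₀ j N (Finset.single_le_sum (fun _ _ => Nat.zero_le _) (Finset.mem_univ j))
  obtain ⟨u, rfl⟩ := (hN i).1 hx
  let M' (j : ι) := (L j).comap (scaledEmbedding p (S j) n N)
  have hu := mem_span_of_descent (q := (p : WittVector p R) ^ (2 * N)) (x := u)
    (flatMod_witt (S := S i) hp _)
    (fun j => bijectiveMod_wittTensorMap (S := S i) (S' := S j) hp (2 * N)) M'
    (fun j v => by
      have h : (p : WittVector p R) ^ (2 * N) • v = (p : WittVector p (S j)) ^ (2 * N) • v := by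
        funext k
        simp [Algebra.smul_def]
      rw [h]
      exact (hN j).2 v)
    (fun j => by
      have hl : (fun k => wittTensorMap p R (S i) (S j) (u k ⊗ₜ 1)) = mapVec (WittVector.map
          (Algebra.TensorProduct.includeLeftRingHom : S i →+* S i ⊗[R] S j)) u := by
        funext k
        rw [wittTensorMap_tmul, map_one, mul_one]
      have hr (y : Fin n → WittVector p (S j)) :
          (fun k => wittTensorMap p R (S i) (S j) (1 ⊗ₜ y k)) = mapVec (WittVector.map
            (Algebra.TensorProduct.includeRight : S j →ₐ[R] S i ⊗[R] S j).toRingHom) y := by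
        funext k
        rw [wittTensorMap_tmul, map_one, one_mul]
      simp_rw [hr, hl]
      rw [← SetLike.mem_coe, ← (scaledEmbedding_injective (p := p) hpT N).mem_set_image,
        ← Submodule.map_coe, SetLike.mem_coe, ← mapVec_scaledEmbedding, Submodule.map_span]
      have h1 := Submodule.subset_span (R := WittVector p (S i ⊗[R] S j))
        (Set.mem_image_of_mem (mapVec (wittLocMap p (Algebra.TensorProduct.includeLeftRingHom :
          S i →+* S i ⊗[R] S j))) hx)
      refine Submodule.span_mono ?_ ((hglue i j).le h1)
      rintro _ ⟨w, hw, rfl⟩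
      obtain ⟨y, rfl⟩ := (hN j).1 hw
      exact ⟨_, ⟨y, hw, rfl⟩, (mapVec_scaledEmbedding _ _ _).symm⟩)
  have h2 := Submodule.mem_map_of_mem (f := scaledEmbedding p (S i) n N) hu
  rw [Submodule.map_span] at h2
  refine Submodule.span_mono ?_ h2
  rintro _ ⟨_, ⟨u₀, hu₀, rfl⟩, rfl⟩
  refine ⟨scaledEmbedding p R n N u₀, fun j => ?_, mapVec_scaledEmbedding _ _ _⟩
  rw [mapVec_scaledEmbedding]
  exact hu₀ j

/-- The descended lattice is special: its determinants are integral since they are so over every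
`Sᵢ`, and they generate the unit ideal of `W(R)` since this holds modulo `p` over every `Sᵢ`. -/
theorem isSpecialLattice_descendedLattice [∀ i, Module.Flat R (S i)]
    (hsurj : JointlySurjective fun i => algebraMap R (S i)) (hp : (p : R) = 0)
    {L : ∀ i, Submodule (WittVector p (S i)) (Fin n → WittLoc p (S i))}
    (hL : ∀ i, IsSpecialLattice (L i))
    (hext : ∀ i, extendLattice (WittVector p (S i)) (wittLocMap p (algebraMap R (S i)))
      (descendedLattice L) = L i) : IsSpecialLattice (descendedLattice (R := R) L) := by
  have hpS (i : ι) : (p : S i) = 0 := by rw [← map_natCast (algebraMap R (S i)), hp, map_zero]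
  have hmapdet {K K' : Type u} [CommRing K] [CommRing K'] (φ : K →+* K') (v : Fin n → Fin n → K) :
      Matrix.det (fun j => mapVec φ (v j)) = φ (Matrix.det v) := (RingHom.map_det φ v).symm
  have hdet (v : Fin n → Fin n → WittLoc p R) (hv : ∀ j, v j ∈ descendedLattice L) :
      Matrix.det v ∈ (1 : Submodule (WittVector p R) (WittLoc p R)) := by
    refine Submodule.mem_one.2 (mem_range_algebraMap_of_forall hp hpS _
      (fun r hr => hsurj.eq_zero (fun i => RingHom.flat_algebraMap_iff.2 inferInstance) hr)
      _ fun i => ?_)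
    rw [← hmapdet]
    exact Submodule.mem_one.1 ((hL i).det_mem fun j => hv j i)
  refine .of_det (Submonoid.powers (p : WittVector p R)) (algebraMap_wittLoc_injective p hp) hdet ?_
  let D := Submodule.span (WittVector p R) {d | ∃ v : Fin n → (Fin n → WittLoc p R),
    (∀ i, v i ∈ descendedLattice L) ∧ d = Matrix.det v}
  -- the ideal generated by the determinants is the unit ideal modulo `p`
  let I : Ideal (WittVector p R) := D.comap (Algebra.linearMap _ _)
  suffices h : I = ⊤ by
    have h1 : (1 : WittVector p R) ∈ I := h ▸ trivial
    have h2 : algebraMap (WittVector p R) (WittLoc p R) 1 ∈ D := h1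
    rwa [map_one] at h2
  refine witt_ideal_eq_top hp ?_
  by_contra hI
  obtain ⟨m, hm, hIm⟩ := Ideal.exists_le_maximal _ hI
  obtain ⟨i, y, hy⟩ := hsurj ⟨m, hm.isPrime⟩
  have hy' : (PrimeSpectrum.comap (algebraMap R (S i)) y).asIdeal = m :=
    congrArg PrimeSpectrum.asIdeal hy
  let P : Ideal (WittVector p (S i)) := y.asIdeal.comap WittVector.constantCoeff
  have h1 : (1 : WittLoc p (S i)) ∈
      Submodule.map (Algebra.linearMap (WittVector p (S i)) (WittLoc p (S i))) P := by
    have h2 := wedgeMap_range (L i) _ (hext i)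
    rw [(hL i).wedge] at h2
    have h3 := h2.le (Submodule.one_le.1 le_rfl)
    refine (Submodule.span_le.2 ?_ : _ ≤ Submodule.map (Algebra.linearMap (WittVector p (S i))
      (WittLoc p (S i))) P) h3
    rintro _ ⟨w, hw, rfl⟩
    choose v hv hvw using hw
    obtain ⟨d, hd⟩ := Submodule.mem_one.1 (hdet v hv)
    have hdI : d ∈ I := by
      change algebraMap _ _ d ∈ D
      rw [hd]
      exact Submodule.subset_span ⟨v, hv, rfl⟩
    refine ⟨WittVector.map (algebraMap R (S i)) d, ?_, ?_⟩
    · have h4 : WittVector.constantCoeff d ∈ m := hIm (Ideal.mem_map_of_mem _ hdI)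
      rw [← hy'] at h4
      exact h4
    · rw [Algebra.linearMap_apply, ← wittLocMap_algebraMap, hd, ← hmapdet]
      exact congrArg Matrix.det (funext hvw)
  obtain ⟨a, ha, ha1⟩ := h1
  have ha2 : a = 1 := algebraMap_wittLoc_injective p (hpS i) (by rw [map_one]; exact ha1)
  rw [ha2] at ha
  exact y.isPrime.one_notMem (by simpa [P] using ha)

end LatticeDescent

/-! ### Covering sieves of the fpqc topology -/

section Site

open Limits Opposite AlgebraicGeometry

variable {C : Type*} [Category* C] (U : C ⥤ CommRingCat.{u})

/-- The sieve `T` on the affine scheme `X` contains a finite jointly surjective family of flat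
morphisms of affine schemes. -/
def ContainsFlatCover (X : Cᵒᵖ) (T : Sieve X) : Prop :=
  ∃ (m : ℕ) (S : Fin m → C) (f : ∀ i, X.unop ⟶ S i), (∀ i, T (f i).op) ∧
    (∀ i, (U.map (f i)).hom.Flat) ∧ JointlySurjective fun i => (U.map (f i)).hom

/-- Every span in the category of algebras `C` can be completed to a commutative square which is a
pushout square of rings. -/
def HasRingPushouts : Prop :=
  ∀ ⦃R S S' : C⦄ (f : R ⟶ S) (g : R ⟶ S'), ∃ (T : C) (i : S ⟶ T) (j : S' ⟶ T),
    f ≫ i = g ≫ j ∧ IsPushout (U.map f) (U.map g) (U.map i) (U.map j)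

variable {U}

/-- As affine schemes are quasi-compact, finitely many members of an fpqc covering suffice. -/
theorem containsFlatCover_of_mem_comap {X : Cᵒᵖ} {P : Presieve X}
    (hP : P ∈ Scheme.fpqcPrecoverage.comap (U.op ⋙ Scheme.Spec) X) :
    ContainsFlatCover U X (Sieve.generate P) := by
  obtain ⟨ι, Y, f, rfl⟩ := P.exists_eq_ofArrows
  rw [Precoverage.mem_comap_iff, Presieve.map_ofArrows] at hP
  obtain ⟨h1, h2⟩ := hP
  let E : PreZeroHypercover ((U.op ⋙ Scheme.Spec).obj X) :=
    ⟨ι, fun i => (U.op ⋙ Scheme.Spec).obj (Y i), fun i => (U.op ⋙ Scheme.Spec).map (f i)⟩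
  change E.presieve₀ ∈ _ at h1 h2
  rw [Scheme.presieve₀_mem_qcPrecoverage_iff] at h1
  replace h2 := (Scheme.presieve₀_mem_precoverage_iff (P := @Flat) E).1 h2
  have hc : IsCompact ((⊤ : Scheme.Opens ((U.op ⋙ Scheme.Spec).obj X)) :
      Set ((U.op ⋙ Scheme.Spec).obj X)) :=
    (isCompact_univ : IsCompact (Set.univ : Set (Spec (U.obj X.unop))))
  obtain ⟨m, σ, V, -, hV⟩ := QuasiCompactCover.exists_isAffineOpen_of_isCompact E hc
  refine ⟨m, fun i => (Y (σ i)).unop, fun i => (f (σ i)).unop, fun i => ?_, fun i => ?_,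
    fun x => ?_⟩
  · exact Sieve.le_generate _ _ _ (Presieve.ofArrows.mk (σ i))
  · exact Flat.SpecMap_iff.1 (h2.2 (σ i))
  · have hx : (x : Spec (U.obj X.unop)) ∈ ⋃ i, E.f (σ i) '' (V i) := hV ▸ trivial
    obtain ⟨i, y, -, hy⟩ := Set.mem_iUnion.1 hx
    exact ⟨i, y, hy⟩

theorem ContainsFlatCover.mem_fpqcTopology {X : Cᵒᵖ} {T : Sieve X}
    (hT : ContainsFlatCover U X T) : T ∈ fpqcTopology U X := by
  obtain ⟨m, S, f, hf, hflat, hsurj⟩ := hT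
  let P : Presieve X := Presieve.ofArrows (fun i => op (S i)) fun i => (f i).op
  have hP : P ∈ Scheme.fpqcPrecoverage.comap (U.op ⋙ Scheme.Spec) X := by
    rw [Precoverage.mem_comap_iff, Presieve.map_ofArrows]
    let E : PreZeroHypercover (Spec (U.obj X.unop)) :=
      ⟨Fin m, fun i => Spec (U.obj (S i)), fun i => Spec.map (U.map (f i))⟩
    have h2 : E.presieve₀ ∈ Scheme.precoverage @Flat (Spec (U.obj X.unop)) := by
      exact (Scheme.presieve₀_mem_precoverage_iff (P := @Flat) E).2
        ⟨fun x => hsurj x, fun i => Flat.SpecMap_iff.2 (hflat i)⟩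
    let 𝒰 : Scheme.Cover (Scheme.precoverage @Flat) (Spec (U.obj X.unop)) := ⟨E, h2⟩
    have : Finite 𝒰.I₀ := inferInstanceAs (Finite (Fin m))
    have (i : 𝒰.I₀) : QuasiCompact (𝒰.f i) := inferInstanceAs (QuasiCompact (Spec.map _))
    have : Scheme.JointlySurjective (Scheme.precoverage.{u} @Flat) :=
      Scheme.instJointlySurjectivePrecoverage (P := @Flat)
    have h1 : QuasiCompactCover 𝒰.toPreZeroHypercover := .of_finite
    exact ⟨Scheme.presieve₀_mem_qcPrecoverage_iff.2 h1, h2⟩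
  refine (fpqcTopology U).superset_covering ?_ (Precoverage.generate_mem_toGrothendieck hP)
  rw [Sieve.generate_le_iff]
  rintro _ _ ⟨i⟩
  exact hf i

theorem ContainsFlatCover.pullback (hU : HasRingPushouts U) {X Y : Cᵒᵖ} {T : Sieve X}
    (hT : ContainsFlatCover U X T) (g : Y ⟶ X) : ContainsFlatCover U Y (T.pullback g) := by
  obtain ⟨m, S, f, hf, hflat, hsurj⟩ := hT
  choose S' i j hij hpush using fun a => hU (f a) g.unop
  refine ⟨m, S', j, fun a => ?_, fun a => ?_, fun x => ?_⟩
  · have h : (j a).op ≫ g = (i a).op ≫ (f a).op := Quiver.Hom.unop_inj (hij a).symm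
    change T _
    rw [h]
    exact T.downward_closed (hf a) _
  · have h : Flat (Spec.map (U.map (j a))) :=
      MorphismProperty.of_isPullback (P := @Flat)
        (isPullback_SpecMap_of_isPushout _ _ _ _ (hpush a))
        (Flat.SpecMap_iff.2 (hflat a))
    exact Flat.SpecMap_iff.1 h
  · obtain ⟨a, y, hy⟩ := hsurj (PrimeSpectrum.comap (U.map g.unop).hom x)
    obtain ⟨z, -, hz⟩ := Scheme.exists_preimage_of_isPullback
      (isPullback_SpecMap_of_isPushout _ _ _ _ (hpush a)) y x hy
    exact ⟨a, z, hz⟩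

theorem ContainsFlatCover.transitive {X : Cᵒᵖ} {T T' : Sieve X}
    (hT : ContainsFlatCover U X T)
    (h : ∀ ⦃Y : Cᵒᵖ⦄ ⦃f : Y ⟶ X⦄, T f → ContainsFlatCover U Y (T'.pullback f)) :
    ContainsFlatCover U X T' := by
  obtain ⟨m, S, f, hf, hflat, hsurj⟩ := hT
  choose m' S' f' hf' hflat' hsurj' using fun i => h (hf i)
  let e := Fintype.equivFin (Σ i, Fin (m' i))
  refine ⟨_, fun s => S' (e.symm s).1 (e.symm s).2,
    fun s => f (e.symm s).1 ≫ f' (e.symm s).1 (e.symm s).2, fun s => hf' _ _, fun s => ?_,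
    fun x => ?_⟩
  · rw [U.map_comp]
    exact (hflat _).comp (hflat' _ _)
  · obtain ⟨i, y, rfl⟩ := hsurj x
    obtain ⟨j, z, rfl⟩ := hsurj' i y
    obtain ⟨s, hs⟩ := e.symm.surjective ⟨i, j⟩
    have key : ∀ s' : Σ i, Fin (m' i), s' = ⟨i, j⟩ → ∃ y,
        PrimeSpectrum.comap (U.map (f s'.1 ≫ f' s'.1 s'.2)).hom y =
          PrimeSpectrum.comap (U.map (f i)).hom (PrimeSpectrum.comap (U.map (f' i j)).hom z) := by
      rintro _ rfl
      exact ⟨z, by rw [U.map_comp]; rfl⟩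
    exact ⟨s, key _ hs⟩

/-- The covering sieves of the fpqc topology on affine schemes are the sieves which contain a
finite jointly surjective family of flat morphisms. -/
theorem mem_fpqcTopology_iff (hU : HasRingPushouts U) {X : Cᵒᵖ} {T : Sieve X} :
    T ∈ fpqcTopology U X ↔ ContainsFlatCover U X T := by
  refine ⟨fun h => ?_, fun h => h.mem_fpqcTopology⟩
  change Precoverage.Saturate _ X T at h
  induction h with
  | of X P hP => exact containsFlatCover_of_mem_comap hP
  | top X =>
    refine ⟨1, fun _ => X.unop, fun _ => 𝟙 _, fun _ => trivial, fun _ => ?_, fun x => ⟨0, x, ?_⟩⟩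
    · rw [U.map_id]; exact RingHom.Flat.id _
    · change PrimeSpectrum.comap (U.map (𝟙 X.unop)).hom x = x
      rw [U.map_id]; rfl
  | pullback X T _ Y f h => exact h.pullback hU f
  | transitive X T T' _ _ h h' => exact h.transitive h'

end Site

/-! ### Tensor products in the categories of algebras -/

section AlgebraSites

open Limits Opposite

variable {k : Type u} [Field k]

section

variable {R S S' : CommAlgCat.{u} k} (f : R ⟶ S) (g : R ⟶ S')

/-- The tensor product `S ⊗[R] S'` of `k`-algebras, for homomorphisms `f : R → S` and `g : R → S'`.
Its `k`-algebra structure is the one through `S`. -/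
def tensorAlg : CommAlgCat.{u} k :=
  let _ := f.hom.toRingHom.toAlgebra
  let _ := g.hom.toRingHom.toAlgebra
  let _ : Algebra k (S ⊗[R] S') :=
    (Algebra.TensorProduct.includeLeftRingHom.comp (algebraMap k S)).toAlgebra
  CommAlgCat.of k (S ⊗[R] S')

/-- The homomorphism `S → S ⊗[R] S'`. -/
def tensorAlgInl : S ⟶ tensorAlg f g :=
  let _ := f.hom.toRingHom.toAlgebra
  let _ := g.hom.toRingHom.toAlgebra
  let _ : Algebra k (S ⊗[R] S') :=
    (Algebra.TensorProduct.includeLeftRingHom.comp (algebraMap k S)).toAlgebra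
  CommAlgCat.ofHom (X := S)
    { (Algebra.TensorProduct.includeLeftRingHom : S →+* S ⊗[R] S') with commutes' := fun _ => rfl }

/-- The homomorphism `S' → S ⊗[R] S'`. -/
def tensorAlgInr : S' ⟶ tensorAlg f g :=
  let _ := f.hom.toRingHom.toAlgebra
  let _ := g.hom.toRingHom.toAlgebra
  let _ : Algebra k (S ⊗[R] S') :=
    (Algebra.TensorProduct.includeLeftRingHom.comp (algebraMap k S)).toAlgebra
  CommAlgCat.ofHom
    { (Algebra.TensorProduct.includeRight : S' →ₐ[R] S ⊗[R] S').toRingHom with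
      commutes' := fun r => by
        change (1 : S) ⊗ₜ[R] algebraMap k S' r = algebraMap k S r ⊗ₜ[R] (1 : S')
        have h1 : algebraMap k S' r = algebraMap R S' (algebraMap k R r) := (g.hom.commutes r).symm
        have h2 : algebraMap k S r = algebraMap R S (algebraMap k R r) := (f.hom.commutes r).symm
        rw [h1, h2, Algebra.algebraMap_eq_smul_one (A := S),
          Algebra.algebraMap_eq_smul_one (A := S'), TensorProduct.smul_tmul] }

theorem tensorAlg_condition : f ≫ tensorAlgInl f g = g ≫ tensorAlgInr f g := by
  let _ := f.hom.toRingHom.toAlgebra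
  let _ := g.hom.toRingHom.toAlgebra
  ext r
  change (algebraMap R S r) ⊗ₜ[R] (1 : S') = (1 : S) ⊗ₜ[R] algebraMap R S' r
  rw [Algebra.algebraMap_eq_smul_one, Algebra.algebraMap_eq_smul_one, TensorProduct.smul_tmul]

theorem isPushout_tensorAlg :
    IsPushout ((forget₂ (CommAlgCat.{u} k) CommRingCat.{u}).map f)
      ((forget₂ (CommAlgCat.{u} k) CommRingCat.{u}).map g)
      ((forget₂ (CommAlgCat.{u} k) CommRingCat.{u}).map (tensorAlgInl f g))
      ((forget₂ (CommAlgCat.{u} k) CommRingCat.{u}).map (tensorAlgInr f g)) :=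
  let _ := f.hom.toRingHom.toAlgebra
  let _ := g.hom.toRingHom.toAlgebra
  CommRingCat.isPushout_tensorProduct R S S'

theorem tensorAlg_exists_desc {X : CommAlgCat.{u} k} (a : S ⟶ X) (b : S' ⟶ X) (h : f ≫ a = g ≫ b) :
    ∃ c : tensorAlg f g ⟶ X, tensorAlgInl f g ≫ c = a ∧ tensorAlgInr f g ≫ c = b := by
  let U := forget₂ (CommAlgCat.{u} k) CommRingCat.{u}
  have hp := isPushout_tensorAlg f g
  have h' : U.map f ≫ U.map a = U.map g ≫ U.map b := by rw [← U.map_comp, h, U.map_comp]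
  let c := hp.desc (U.map a) (U.map b) h'
  have h1 : U.map (tensorAlgInl f g) ≫ c = U.map a := hp.inl_desc ..
  have h2 : U.map (tensorAlgInr f g) ≫ c = U.map b := hp.inr_desc ..
  refine ⟨CommAlgCat.ofHom (X := tensorAlg f g) { c.hom with commutes' := fun r => ?_ }, ?_, ?_⟩
  · have h3 := ConcreteCategory.congr_hom h1 (algebraMap k S r)
    exact h3.trans (a.hom.commutes r)
  · ext s
    exact ConcreteCategory.congr_hom h1 s
  · ext s
    exact ConcreteCategory.congr_hom h2 s

variable {p : ℕ} [CharP k p]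

theorem natCast_eq_zero_of_algebra (R : Type*) [CommRing R] [Algebra k R] : (p : R) = 0 := by
  rw [← map_natCast (algebraMap k R), CharP.cast_eq_zero, map_zero]

theorem perfectRing_tensorAlg [Fact p.Prime] [PerfectRing R p] [PerfectRing S p]
    [PerfectRing S' p] : PerfectRing (tensorAlg f g) p :=
  let _ := f.hom.toRingHom.toAlgebra
  let _ := g.hom.toRingHom.toAlgebra
  perfectRing_tensorProduct (R := R) (S := S) (S' := S') (natCast_eq_zero_of_algebra (k := k) R)

end

theorem hasRingPushouts_commAlgCat : HasRingPushouts (forget₂ (CommAlgCat.{u} k) CommRingCat.{u}) :=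
  fun _ _ _ f g => ⟨tensorAlg f g, tensorAlgInl f g, tensorAlgInr f g, tensorAlg_condition f g,
    isPushout_tensorAlg f g⟩

variable {p : ℕ} [Fact p.Prime] [CharP k p]

section

variable {R S S' : PerfectAlg p k} (f : R ⟶ S) (g : R ⟶ S')

/-- The tensor product of perfect `k`-algebras over a perfect `k`-algebra. -/
def perfectTensor : PerfectAlg p k :=
  ⟨tensorAlg f.hom g.hom,
    have := R.property
    have := S.property
    have := S'.property
    perfectRing_tensorAlg f.hom g.hom⟩

/-- The homomorphism `S → S ⊗[R] S'`. -/
def perfectTensorInl : S ⟶ perfectTensor f g := ObjectProperty.homMk (tensorAlgInl f.hom g.hom)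

/-- The homomorphism `S' → S ⊗[R] S'`. -/
def perfectTensorInr : S' ⟶ perfectTensor f g := ObjectProperty.homMk (tensorAlgInr f.hom g.hom)

theorem perfectTensor_condition : f ≫ perfectTensorInl f g = g ≫ perfectTensorInr f g :=
  ObjectProperty.hom_ext _ (tensorAlg_condition f.hom g.hom)

end

theorem hasRingPushouts_perfectAlg : HasRingPushouts (PerfectAlg.toCommRing p k) :=
  fun _ _ _ f g => ⟨perfectTensor f g, perfectTensorInl f g, perfectTensorInr f g,
    perfectTensor_condition f g, isPushout_tensorAlg f.hom g.hom⟩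

/-- The inclusion of affine perfect schemes into affine schemes. -/
abbrev perfectInclusion (p : ℕ) [Fact p.Prime] (k : Type u) [Field k] :
    (PerfectAlg p k)ᵒᵖ ⥤ (CommAlgCat.{u} k)ᵒᵖ :=
  (ObjectProperty.ι _).op

/-- The inclusion of affine perfect schemes is continuous: it preserves covers, and compatibility
of families, since fibre products of affine perfect schemes are perfect. -/
theorem isContinuous_perfectInclusion :
    (perfectInclusion p k).IsContinuous (fpqcTopology (PerfectAlg.toCommRing p k))
      (fpqcTopology (forget₂ (CommAlgCat.{u} k) CommRingCat.{u})) := by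
  refine Functor.isContinuous_of_coverPreserving ⟨?_⟩ ⟨fun {R T} hT => ?_⟩
  · intro F Z T x hx Y₁ Y₂ X f₁ f₂ g₁ g₂ hg₁ hg₂ h
    obtain ⟨c, hc₁, hc₂⟩ := tensorAlg_exists_desc g₁.unop.hom g₂.unop.hom f₁.unop f₂.unop
      (congrArg Quiver.Hom.unop h)
    have e₁ : f₁ = c.op ≫ (perfectInclusion p k).map (perfectTensorInl g₁.unop g₂.unop).op :=
      Quiver.Hom.unop_inj hc₁.symm
    have e₂ : f₂ = c.op ≫ (perfectInclusion p k).map (perfectTensorInr g₁.unop g₂.unop).op :=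
      Quiver.Hom.unop_inj hc₂.symm
    have := hx (perfectTensorInl g₁.unop g₂.unop).op (perfectTensorInr g₁.unop g₂.unop).op hg₁ hg₂
      (Quiver.Hom.unop_inj (perfectTensor_condition g₁.unop g₂.unop))
    rw [e₁, e₂]
    exact (ConcreteCategory.congr_hom (F.obj.map_comp _ c.op.op) _).trans
      ((congrArg (F.obj.map c.op.op) this).trans
        (ConcreteCategory.congr_hom (F.obj.map_comp _ c.op.op) _).symm)
  · obtain ⟨m, S, f, hf, hflat, hsurj⟩ := (mem_fpqcTopology_iff hasRingPushouts_perfectAlg).1 hT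
    refine ContainsFlatCover.mem_fpqcTopology
      ⟨m, fun i => (S i).obj, fun i => (f i).hom, fun i => ?_, hflat, hsurj⟩
    exact Sieve.image_mem_functorPushforward (perfectInclusion p k) T (hf i)

end AlgebraSites

/-! ### The sheaf of special lattices -/

section LatticeSheaf

open Limits Opposite

variable {p : ℕ} [Fact p.Prime] {k : Type u} [Field k] [CharP k p] {n : ℕ}

/-- The presheaf of special lattices is separated. -/
theorem specialLattices_ext {R : PerfectAlg p k} {T : Sieve (op R)}
    (hT : ContainsFlatCover (PerfectAlg.toCommRing p k) (op R) T)
    {L L' : (specialLattices p k n).obj R}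
    (h : ∀ (S : PerfectAlg p k) (f : R ⟶ S), T f.op →
      (specialLattices p k n).map f L = (specialLattices p k n).map f L') : L = L' := by
  obtain ⟨m, S, f, hf, hflat, hsurj⟩ := hT
  have := R.property
  have (i : Fin m) := (S i).property
  refine Subtype.ext (IsSpecialLattice.eq_of_forall (p := p) (R := R.obj) (S := fun i => (S i).obj)
    (natCast_eq_zero_of_algebra (k := k) _) (fun i => natCast_eq_zero_of_algebra (k := k) _)
    (f := fun i => (f i).hom.hom.toRingHom)
    (fun r hr => hsurj.eq_zero hflat hr) L.2 L'.2 fun i => ?_)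
  exact congrArg Subtype.val (h (S i) (f i) (hf i))

/-- Special lattices can be glued along finite faithfully flat families. -/
theorem exists_map_specialLattices_eq {R : PerfectAlg p k} {m : ℕ} {S : Fin m → PerfectAlg p k}
    (f : ∀ i, R ⟶ S i) (hflat : ∀ i, (f i).hom.hom.toRingHom.Flat)
    (hsurj : JointlySurjective fun i => (f i).hom.hom.toRingHom)
    (L : ∀ i, (specialLattices p k n).obj (S i))
    (hL : ∀ i j, (specialLattices p k n).map (perfectTensorInl (f i) (f j)) (L i) =
      (specialLattices p k n).map (perfectTensorInr (f i) (f j)) (L j)) :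
    ∃ L₀ : (specialLattices p k n).obj R, ∀ i, (specialLattices p k n).map (f i) L₀ = L i := by
  have := R.property
  have (i : Fin m) := (S i).property
  let _ (i : Fin m) : Algebra R.obj (S i).obj := (f i).hom.hom.toRingHom.toAlgebra
  have (i : Fin m) : Module.Flat R.obj (S i).obj := hflat i
  have hp : (p : R.obj) = 0 := natCast_eq_zero_of_algebra (k := k) _
  have hext := extendLattice_descendedLattice (p := p) (R := R.obj) (S := fun i => (S i).obj) hp
    (L := fun i => (L i).1) (fun i => (L i).2.toIsLattice)
    (fun i j => congrArg Subtype.val (hL i j))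
  exact ⟨⟨_, isSpecialLattice_descendedLattice hsurj hp (fun i => (L i).2) hext⟩,
    fun i => Subtype.ext (hext i)⟩

theorem isSheaf_specialLattices :
    Presheaf.IsSheaf (fpqcTopology (PerfectAlg.toCommRing p k))
      (toPresheaf (specialLattices p k n)) := by
  rw [isSheaf_iff_isSheaf_of_type]
  intro X T hT x hx
  have hT' := (mem_fpqcTopology_iff hasRingPushouts_perfectAlg).1 hT
  refine existsUnique_of_exists_of_unique ?_ fun L L' hL hL' => ?_
  · obtain ⟨m, S, f, hf, hflat, hsurj⟩ := hT'
    obtain ⟨L, hL⟩ := exists_map_specialLattices_eq f hflat hsurj (fun i => x (f i).op (hf i))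
      fun i j => hx (perfectTensorInl (f i) (f j)).op (perfectTensorInr (f i) (f j)).op
        (hf i) (hf j) (Quiver.Hom.unop_inj (perfectTensor_condition (f i) (f j)))
    refine ⟨L, fun Y g hg => ?_⟩
    -- over a member `Y` of the sieve, compare after pulling back the finite cover
    let T' : Sieve X := Sieve.generate (Presieve.ofArrows (fun i => op (S i)) fun i => (f i).op)
    have hcov : ContainsFlatCover (PerfectAlg.toCommRing p k) X T' :=
      ⟨m, S, f, fun i => Sieve.le_generate _ _ _ (Presieve.ofArrows.mk i), hflat, hsurj⟩
    refine specialLattices_ext (hcov.pullback hasRingPushouts_perfectAlg g) fun S' h hh => ?_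
    obtain ⟨_, w, _, ⟨i⟩, hw⟩ := hh
    refine Eq.trans ?_ (hx w h.op (hf i) hg hw)
    change (specialLattices p k n).map h ((specialLattices p k n).map g.unop L) =
      (specialLattices p k n).map w.unop (x (f i).op (hf i))
    rw [← hL i, ← ConcreteCategory.comp_apply, ← ConcreteCategory.comp_apply, ← Functor.map_comp,
      ← Functor.map_comp]
    have hw' : f i ≫ w.unop = g.unop ≫ h := congrArg Quiver.Hom.unop hw
    rw [hw']
  · exact specialLattices_ext hT' fun S f hf => (hL f.op hf).trans (hL' f.op hf).symm

end LatticeSheaf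

/-! ### Perfection of flat covers -/

section Perfection

open Limits Opposite

variable {p : ℕ}

theorem perfectRing_exists_pow_eq {R : Type*} [CommRing R] [PerfectRing R p] (N : ℕ) (x : R) :
    ∃ y, y ^ p ^ N = x := by
  induction N generalizing x with
  | zero => exact ⟨x, by simp⟩
  | succ N ih =>
    obtain ⟨y, rfl⟩ := ih x
    obtain ⟨z, rfl⟩ := (PerfectRing.bijective_frobenius (R := R) (p := p)).2 y
    exact ⟨z, by rw [pow_succ', pow_mul]⟩

theorem perfectRing_pow_injective {R : Type*} [CommRing R] [PerfectRing R p] (N : ℕ) :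
    Function.Injective fun x : R => x ^ p ^ N := by
  induction N with
  | zero => intro x y h; simpa using h
  | succ N ih =>
    intro x y h
    refine (PerfectRing.bijective_frobenius (R := R) (p := p)).1 (ih ?_)
    simpa only [pow_succ', pow_mul] using! h

variable [Fact p.Prime]

/-- A perfect ring `S'` which is `p`-radical over a flat algebra `S` over a perfect ring `R` is
flat over `R`: by the equational criterion, it suffices to trivialize relations with values in
`S'`, and a power of such a relation comes from a relation in `S`, whose trivialization has
`p`-power roots. -/
theorem flat_comp_of_isPRadical {R S S' : Type*} [CommRing R] [CommRing S] [CommRing S']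
    [PerfectRing R p] [PerfectRing S' p] (hp : (p : R) = 0) {f : R →+* S} {h : S →+* S'}
    (hf : f.Flat) [IsPRadical h p] : (h.comp f).Flat := by
  let _ := f.toAlgebra
  let _ := (h.comp f).toAlgebra
  have : Module.Flat R S := hf
  change Module.Flat R S'
  rcases subsingleton_or_nontrivial S' with hS' | hS'
  · infer_instance
  have := h.domain_nontrivial
  have := f.domain_nontrivial
  have hpS : (p : S) = 0 := by rw [← map_natCast f, hp, map_zero]
  have hpS' : (p : S') = 0 := by rw [← map_natCast h, hpS, map_zero]
  have := charP_of_natCast_eq_zero hp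
  have := charP_of_natCast_eq_zero hpS
  have := charP_of_natCast_eq_zero hpS'
  refine Module.Flat.of_forall_isTrivialRelation fun {l r y} hr => ?_
  choose N₀ s₀ hs₀ using fun i => IsPRadical.pow_mem h p (y i)
  -- the `p ^ N`-th powers of all `y i` come from `S`
  let N := ∑ i, N₀ i
  have hN (i : Fin l) : ∃ s, h s = y i ^ p ^ N := by
    have hle : N₀ i ≤ N := Finset.single_le_sum (fun _ _ => Nat.zero_le _) (Finset.mem_univ i)
    refine ⟨s₀ i ^ p ^ (N - N₀ i), ?_⟩
    rw [map_pow, hs₀, ← pow_mul, ← pow_add, Nat.add_sub_cancel' hle]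
  choose s hs using hN
  have h1 : h (∑ i, f (r i ^ p ^ N) * s i) = 0 := by
    have h2 : (∑ i, r i • y i) ^ p ^ N = 0 := by
      rw [hr, zero_pow (pow_pos (Fact.out : p.Prime).pos N).ne']
    rw [sum_pow_char_pow] at h2
    rw [map_sum, ← h2]
    refine Finset.sum_congr rfl fun i _ => ?_
    rw [Algebra.smul_def, mul_pow, map_mul, hs, map_pow, map_pow]
    rfl
  obtain ⟨M, hM⟩ := mem_pNilradical.1 (IsPRadical.ker_le h p h1)
  rw [sum_pow_char_pow] at hM
  obtain ⟨m, a, z, ha, hra⟩ := Module.Flat.isTrivialRelation_of_sum_smul_eq_zero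
    (R := R) (M := S) (f := fun i => r i ^ p ^ (N + M)) (x := fun i => s i ^ p ^ M) (by
      rw [← hM]
      refine Finset.sum_congr rfl fun i _ => ?_
      rw [Algebra.smul_def, mul_pow, ← map_pow, ← pow_mul, ← pow_add]
      rfl)
  replace ha (i : Fin l) : s i ^ p ^ M = ∑ j, a i j • z j := ha i
  replace hra (j : Fin m) : ∑ i, r i ^ p ^ (N + M) * a i j = 0 := hra j
  -- take `p ^ (N + M)`-th roots of the coefficients in `R` and of the elements in `S'`
  choose b hb using fun i j => perfectRing_exists_pow_eq (p := p) (N + M) (a i j)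
  choose w hw using fun j => perfectRing_exists_pow_eq (p := p) (N + M) (h (z j))
  refine ⟨m, b, w, fun i => perfectRing_pow_injective (p := p) (N + M) ?_,
    fun j => perfectRing_pow_injective (p := p) (N + M) ?_⟩
  · change y i ^ p ^ (N + M) = (∑ j, b i j • w j) ^ p ^ (N + M)
    rw [pow_add, pow_mul, ← hs, ← map_pow, ha i, map_sum, ← pow_add, sum_pow_char_pow]
    refine Finset.sum_congr rfl fun j _ => ?_
    rw [Algebra.smul_def, Algebra.smul_def, mul_pow, hw, map_mul, ← map_pow, hb]
    rfl
  · change (∑ i, r i * b i j) ^ p ^ (N + M) = 0 ^ p ^ (N + M)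
    rw [zero_pow (pow_pos (Fact.out : p.Prime).pos _).ne', sum_pow_char_pow, ← hra j]
    refine Finset.sum_congr rfl fun i _ => ?_
    rw [mul_pow, hb]

theorem comap_surjective_of_isPRadical {S S' : Type*} [CommRing S] [CommRing S'] (h : S →+* S')
    [IsPRadical h p] : Function.Surjective (PrimeSpectrum.comap h) := by
  refine (PrimeSpectrum.isHomeomorph_comap h (fun x => ?_)
    ((IsPRadical.ker_le h p).trans pNilradical_le_nilradical)).surjective
  obtain ⟨n, y, hy⟩ := IsPRadical.pow_mem h p x
  exact ⟨p ^ n, pow_pos (Fact.out : p.Prime).pos n, y, hy⟩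

variable {k : Type u} [Field k] [CharP k p]

variable (p) in
/-- Every `k`-algebra has a perfection. The zero ring does not have characteristic `p`, so that
`PerfectClosure` does not apply to it, but it is perfect. -/
theorem exists_isPRadical_perfectAlg (S : CommAlgCat.{u} k) :
    ∃ (S' : PerfectAlg p k) (h : S ⟶ S'.obj), IsPRadical h.hom.toRingHom p := by
  rcases subsingleton_or_nontrivial S with hS | hS
  · refine ⟨⟨S, ⟨fun _ _ _ => Subsingleton.elim _ _, fun _ => ⟨0, Subsingleton.elim _ _⟩⟩⟩, 𝟙 S,
      ⟨fun x => ⟨0, x, Subsingleton.elim _ _⟩, fun x _ => ?_⟩⟩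
    rw [Subsingleton.elim x 0]
    exact Submodule.zero_mem _
  · have := charP_of_natCast_eq_zero (natCast_eq_zero_of_algebra (k := k) (p := p) S)
    let _ : Algebra k (PerfectClosure S p) :=
      ((PerfectClosure.of S p).comp (algebraMap k S)).toAlgebra
    have h2 : PerfectRing (CommAlgCat.of k (PerfectClosure S p)) p :=
      inferInstanceAs (PerfectRing (PerfectClosure S p) p)
    exact ⟨⟨CommAlgCat.of k (PerfectClosure S p), h2⟩,
      CommAlgCat.ofHom (X := S) { PerfectClosure.of S p with commutes' := fun _ => rfl },
      PerfectClosure.isPRadical S p⟩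

/-- Every flat cover of a perfect affine scheme is refined by its perfection, which is a flat
cover. -/
theorem isCocontinuous_perfectInclusion :
    (perfectInclusion p k).IsCocontinuous (fpqcTopology (PerfectAlg.toCommRing p k))
      (fpqcTopology (forget₂ (CommAlgCat.{u} k) CommRingCat.{u})) := by
  refine ⟨fun {R T} hT => ?_⟩
  obtain ⟨m, S, f, hf, hflat, hsurj⟩ := (mem_fpqcTopology_iff hasRingPushouts_commAlgCat).1 hT
  choose S' h hh using fun i => exists_isPRadical_perfectAlg p (S i)
  have := R.unop.property
  have (i : Fin m) := (S' i).property
  refine ContainsFlatCover.mem_fpqcTopology ⟨m, S', fun i => ObjectProperty.homMk (f i ≫ h i),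
    fun i => T.downward_closed (hf i) (h i).op, fun i => ?_, fun x => ?_⟩
  · exact flat_comp_of_isPRadical (p := p) (R := R.unop.obj) (S' := (S' i).obj)
      (natCast_eq_zero_of_algebra (k := k) _) (hflat i)
  · obtain ⟨i, y, rfl⟩ := hsurj x
    obtain ⟨z, rfl⟩ := comap_surjective_of_isPRadical (p := p) (h i).hom.toRingHom y
    exact ⟨i, z, rfl⟩

end Perfection

/-! ### Comparison with the Grassmannian -/

section ZariskiLocal

open Limits Opposite

theorem perfectRing_localizationAway {R : Type*} [CommRing R] (p : ℕ) [Fact p.Prime]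
    [PerfectRing R p] (d : R) : PerfectRing (Localization.Away d) p := by
  have hp : 1 ≤ p := (Fact.out : p.Prime).one_le
  have hfrob := PerfectRing.bijective_frobenius (R := R) (p := p)
  let M := Submonoid.powers d
  constructor
  constructor
  · intro x y hxy
    obtain ⟨⟨a, b⟩, s, rfl, rfl⟩ : ∃ (ab : R × R) (s : M),
        IsLocalization.mk' (Localization.Away d) ab.1 s = x ∧
          IsLocalization.mk' (Localization.Away d) ab.2 s = y := by
      obtain ⟨a, s, rfl⟩ := IsLocalization.exists_mk'_eq M x
      obtain ⟨b, t, rfl⟩ := IsLocalization.exists_mk'_eq M y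
      refine ⟨(a * t, b * s), s * t, ?_, ?_⟩
      · exact IsLocalization.mk'_cancel a s t
      · rw [mul_comm s t]; exact IsLocalization.mk'_cancel b t s
    change _ ^ p = _ ^ p at hxy
    rw [← IsLocalization.mk'_pow, ← IsLocalization.mk'_pow, IsLocalization.mk'_eq_iff_eq] at hxy
    obtain ⟨c, hc⟩ := (IsLocalization.eq_iff_exists M (Localization.Away d)).1 hxy
    rw [IsLocalization.mk'_eq_iff_eq]
    refine (IsLocalization.eq_iff_exists M (Localization.Away d)).2 ⟨c, hfrob.1 ?_⟩
    change (c * (s * a)) ^ p = (c * (s * b)) ^ p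
    obtain ⟨q, rfl⟩ := Nat.exists_eq_add_of_le' hp
    have h : ∀ e : R, (c * (s * e)) ^ (q + 1) = c ^ q * (c * (s ^ (q + 1) * e ^ (q + 1))) :=
      fun e => by ring
    rw [h, h]
    exact congrArg _ hc
  · intro y
    obtain ⟨a, s, rfl⟩ := IsLocalization.exists_mk'_eq M y
    obtain ⟨b, hb⟩ := hfrob.2 (a * s ^ (p - 1))
    refine ⟨IsLocalization.mk' _ b s, ?_⟩
    change IsLocalization.mk' _ b s ^ p = _
    change b ^ p = _ at hb
    rw [← IsLocalization.mk'_pow, hb]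
    have h : s ^ p = s * s ^ (p - 1) := by rw [← pow_succ', Nat.sub_add_cancel hp]
    rw [h]
    exact IsLocalization.mk'_cancel a s (s ^ (p - 1))

variable {p : ℕ} [Fact p.Prime] {k : Type u} [Field k]

/-- The localization of a perfect `k`-algebra at an element. -/
def perfectAway (R : PerfectAlg p k) (d : R.obj) : PerfectAlg p k :=
  ⟨CommAlgCat.of k (Localization.Away d),
    have := R.property
    perfectRing_localizationAway p d⟩

/-- The localization map. -/
def toPerfectAway (R : PerfectAlg p k) (d : R.obj) : R ⟶ perfectAway R d :=
  ObjectProperty.homMk (CommAlgCat.ofHom (Algebra.algHom k R.obj (Localization.Away d)))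

/-- If `d₁, …, dₘ` generate the unit ideal of `R`, the localizations of `R` at them form a flat
cover. -/
theorem containsFlatCover_of_toPerfectAway {R : PerfectAlg p k} {m : ℕ} {a d : Fin m → R.obj}
    (had : ∑ j, a j * d j = 1) {T : Sieve (op R)} (hT : ∀ j, T (toPerfectAway R (d j)).op) :
    ContainsFlatCover (PerfectAlg.toCommRing p k) (op R) T := by
  refine ⟨m, fun j => perfectAway R (d j), fun j => toPerfectAway R (d j), hT, fun j => ?_,
    fun x => ?_⟩
  · exact (RingHom.flat_algebraMap_iff (R := R.obj) (S := Localization.Away (d j))).2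
      (IsLocalization.flat _ (Submonoid.powers (d j)))
  · obtain ⟨j, hj⟩ : ∃ j, d j ∉ x.asIdeal := by
      by_contra! h
      refine x.isPrime.one_notMem ?_
      have h1 : ∑ j, a j * d j ∈ x.asIdeal :=
        Ideal.sum_mem _ fun j _ => Ideal.mul_mem_left _ _ (h j)
      exact had ▸ h1
    have h2 : x ∈ Set.range (PrimeSpectrum.comap (algebraMap R.obj (Localization.Away (d j)))) := by
      rw [PrimeSpectrum.localization_away_comap_range (Localization.Away (d j)) (d j)]
      exact hj
    obtain ⟨y, hy⟩ := h2
    exact ⟨j, y, hy⟩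

end ZariskiLocal

section Comparison

open Limits Opposite

variable (p : ℕ) [Fact p.Prime] (k : Type u) [Field k] [CharP k p] (n : ℕ)

/-- The map which sends the coset of `g` to the special lattice `g • W(R) ^ n`. -/
def cosetToLattice :
    ObjectProperty.ι (fun R : CommAlgCat.{u} k => PerfectRing R p) ⋙ cosetFunctor p k n ⟶
      specialLattices p k n where
  app R := TypeCat.ofHom fun x => Quotient.liftOn' x
    (fun g : Matrix.SpecialLinearGroup (Fin n) (WittLoc p R.obj) =>
      (⟨matrixSMul g.1 (standardLattice (WittVector p R.obj) (WittLoc p R.obj) n), by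
        have := R.property
        exact isSpecialLattice_matrixSMul (Submonoid.powers (p : WittVector p R.obj))
          (algebraMap_wittLoc_injective p (natCast_eq_zero_of_algebra (k := k) _)) g.2⟩ :
        {L : Submodule (WittVector p R.obj) (Fin n → WittLoc p R.obj) // IsSpecialLattice L})) <| by
    intro (g : Matrix.SpecialLinearGroup (Fin n) (WittLoc p R.obj))
      (h : Matrix.SpecialLinearGroup (Fin n) (WittLoc p R.obj)) hgh
    obtain ⟨c, hc⟩ := QuotientGroup.leftRel_apply.1 hgh
    have h1 : h = g * (Matrix.SpecialLinearGroup.map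
        (algebraMap (WittVector p R.obj) (WittLoc p R.obj)) c :
          Matrix.SpecialLinearGroup (Fin n) (WittLoc p R.obj)) := eq_mul_of_inv_mul_eq hc.symm
    rw [h1]
    exact Subtype.ext (matrixSMul_mul_map (A := WittVector p R.obj) g c).symm
  naturality R S f := by
    ext x
    induction x using Quotient.inductionOn' with
    | h g =>
      refine Subtype.ext ?_
      exact (extendLattice_matrixSMul (WittVector.map f.hom.hom.toRingHom) _
        (wittLocMap_algebraMap p f.hom.hom.toRingHom) g.1).symm

/-- The stabilizer of the standard lattice is `SLₙ(W(R))`. -/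
theorem cosetToLattice_injective (R : PerfectAlg p k) :
    Function.Injective ((cosetToLattice p k n).app R) := by
  intro x y hxy
  induction x using Quotient.inductionOn' with
  | h g =>
    induction y using Quotient.inductionOn' with
    | h h =>
      have := R.property
      refine Quotient.sound' ?_
      rw [QuotientGroup.leftRel_apply]
      exact exists_map_eq_of_matrixSMul_eq
        (algebraMap_wittLoc_injective p (natCast_eq_zero_of_algebra (k := k) R.obj))
        (congrArg Subtype.val hxy)

/-- A special lattice is free with a basis of determinant `1` after inverting the reduction modulo
`p` of the determinant of `n` of its elements, and these reductions generate the unit ideal. -/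
theorem containsFlatCover_cosetToLattice {R : PerfectAlg p k} (L : (specialLattices p k n).obj R)
    {T : Sieve (op R)} (hT : ∀ (S : PerfectAlg p k) (f : R ⟶ S),
      (∃ x, (cosetToLattice p k n).app S x = (specialLattices p k n).map f L) → T f.op) :
    ContainsFlatCover (PerfectAlg.toCommRing p k) (op R) T := by
  obtain ⟨m, a, v, hv, hav⟩ := exists_sum_det_eq_one L.2.one_mem_span
  choose d hd using fun j => Submodule.mem_one.1 (L.2.det_mem (v := v j) (hv j))
  have := R.property
  have hinj := algebraMap_wittLoc_injective p (natCast_eq_zero_of_algebra (k := k) (p := p) R.obj)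
  have had : ∑ j, a j * d j = 1 := by
    apply hinj
    rw [map_sum, map_one, ← hav]
    refine Finset.sum_congr rfl fun j _ => ?_
    rw [map_mul, hd, Algebra.smul_def]
  refine containsFlatCover_of_toPerfectAway (a := fun j => WittVector.constantCoeff (a j))
    (d := fun j => WittVector.constantCoeff (d j)) ?_ fun j => hT _ _ ?_
  · rw [← map_one (WittVector.constantCoeff (p := p) (R := R.obj)), ← had, map_sum]
    exact Finset.sum_congr rfl fun j _ => (map_mul _ _ _).symm
  · let f := toPerfectAway R (WittVector.constantCoeff (d j))
    let L' := (specialLattices p k n).map f L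
    have := (perfectAway R (WittVector.constantCoeff (d j))).property
    obtain ⟨g, hg⟩ := L'.2.exists_eq_matrixSMul
      (v := fun i => mapVec (wittLocMap p f.hom.hom.toRingHom) (v j i))
      (fun i => Submodule.subset_span ⟨_, hv j i, rfl⟩)
      (d := WittVector.map f.hom.hom.toRingHom (d j))
      ((witt_isUnit_iff (natCast_eq_zero_of_algebra (k := k) _) _).2
        (show IsUnit (algebraMap R.obj (Localization.Away (WittVector.constantCoeff (d j)))
          (WittVector.constantCoeff (d j))) from IsLocalization.Away.algebraMap_isUnit _))
      (by
        rw [← wittLocMap_algebraMap, hd]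
        exact (RingHom.map_det (wittLocMap p f.hom.hom.toRingHom) (v j)).symm)
    exact ⟨Quotient.mk'' g, Subtype.ext hg.symm⟩

end Comparison

section Iso

open Limits Opposite

variable (p : ℕ) [Fact p.Prime] (k : Type u) [Field k] [CharP k p] (n : ℕ)

/-- `cosetToLattice`, as a morphism of presheaves on affine perfect schemes. -/
def cosetToLatticePresheaf :
    (perfectInclusion p k).op ⋙ toPresheaf (cosetFunctor p k n ⋙ uliftFunctor.{u + 1}) ⟶
      toPresheaf (specialLattices p k n ⋙ uliftFunctor.{u + 1}) where
  app R := uliftFunctor.{u + 1}.map ((cosetToLattice p k n).app R.unop.unop)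
  naturality R S f := by
    exact congrArg (fun g => uliftFunctor.{u + 1}.map g)
      ((cosetToLattice p k n).naturality f.unop.unop)

/-- The morphism from the coset functor to the Grassmannian, restricted to perfect algebras. -/
def cosetToGrassmannian :
    (perfectInclusion p k).op ⋙ toPresheaf (cosetFunctor p k n ⋙ uliftFunctor.{u + 1}) ⟶
      (perfectInclusion p k).op ⋙ (grassmannian p k n).obj :=
  Functor.whiskerLeft (perfectInclusion p k).op (toSheafify _ _)

/-- The map from cosets to special lattices becomes an isomorphism upon sheafification. -/
theorem W_cosetToLatticePresheaf :
    (fpqcTopology (PerfectAlg.toCommRing p k)).W (cosetToLatticePresheaf p k n) := by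
  have h1 : Presheaf.IsLocallyInjective (fpqcTopology (PerfectAlg.toCommRing p k))
      (cosetToLatticePresheaf p k n) :=
    Presheaf.isLocallyInjective_of_injective _ _ fun R x y hxy => ULift.ext _ _ <|
      cosetToLattice_injective p k n R.unop.unop (congrArg ULift.down hxy)
  have h2 : Presheaf.IsLocallySurjective (fpqcTopology (PerfectAlg.toCommRing p k))
      (cosetToLatticePresheaf p k n) := by
    refine ⟨fun {R} L =>
      (containsFlatCover_cosetToLattice p k n L.down fun S f hf => ?_).mem_fpqcTopology⟩
    obtain ⟨x, hx⟩ := hf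
    exact ⟨ULift.up x, congrArg ULift.up hx⟩
  exact GrothendieckTopology.W_of_isLocallyBijective _ _

/-- The restriction of the Grassmannian to perfect algebras is the sheafification of the restricted
coset functor, because the inclusion of affine perfect schemes is cocontinuous. -/
theorem W_cosetToGrassmannian :
    (fpqcTopology (PerfectAlg.toCommRing p k)).W (cosetToGrassmannian p k n) := by
  have := isCocontinuous_perfectInclusion (p := p) (k := k)
  have hW := (fpqcTopology (forget₂ (CommAlgCat.{u} k) CommRingCat.{u})).W_toSheafify
    (toPresheaf (cosetFunctor p k n ⋙ uliftFunctor.{u + 1}))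
  have := hW.isLocallyInjective
  have := hW.isLocallySurjective
  have h1 : Presheaf.IsLocallyInjective (fpqcTopology (PerfectAlg.toCommRing p k))
      (cosetToGrassmannian p k n) :=
    Presheaf.isLocallyInjective_whisker _
      (fpqcTopology (forget₂ (CommAlgCat.{u} k) CommRingCat.{u}))
      (perfectInclusion p k)
      (toSheafify (fpqcTopology (forget₂ (CommAlgCat.{u} k) CommRingCat.{u}))
        (toPresheaf (cosetFunctor p k n ⋙ uliftFunctor.{u + 1})))
  have h2 : Presheaf.IsLocallySurjective (fpqcTopology (PerfectAlg.toCommRing p k))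
      (cosetToGrassmannian p k n) :=
    Presheaf.isLocallySurjective_whisker _
      (fpqcTopology (forget₂ (CommAlgCat.{u} k) CommRingCat.{u}))
      (perfectInclusion p k)
      (toSheafify (fpqcTopology (forget₂ (CommAlgCat.{u} k) CommRingCat.{u}))
        (toPresheaf (cosetFunctor p k n ⋙ uliftFunctor.{u + 1})))
  exact GrothendieckTopology.W_of_isLocallyBijective _ _

/-- Two morphisms `X ⟶ Y`, `X ⟶ Z` of presheaves which become isomorphisms upon sheafification
identify `Y` with `Z` if these are sheaves. -/
theorem exists_iso_of_W {C D : Type*} [Category* C] [Category* D] {J : GrothendieckTopology C}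
    {X Y Z : Cᵒᵖ ⥤ D} {f : X ⟶ Y} {g : X ⟶ Z} (hf : J.W f) (hg : J.W g)
    (hY : Presheaf.IsSheaf J Y) (hZ : Presheaf.IsSheaf J Z) : ∃ e : Y ≅ Z, f ≫ e.hom = g := by
  obtain ⟨a, ha⟩ := (hf Z hZ).2 g
  obtain ⟨b, hb⟩ := (hg Y hY).2 f
  change f ≫ a = g at ha
  change g ≫ b = f at hb
  refine ⟨⟨a, b, (hf Y hY).1 ?_, (hg Z hZ).1 ?_⟩, ha⟩
  · change f ≫ a ≫ b = f ≫ 𝟙 Y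
    rw [← Category.assoc, ha, hb, Category.comp_id]
  · change g ≫ b ≫ a = g ≫ 𝟙 Z
    rw [← Category.assoc, hb, ha, Category.comp_id]

theorem isSheaf_restrict_grassmannian :
    Presheaf.IsSheaf (fpqcTopology (PerfectAlg.toCommRing p k))
      ((perfectInclusion p k).op ⋙ (grassmannian p k n).obj) :=
  have := isContinuous_perfectInclusion (p := p) (k := k)
  (perfectInclusion p k).op_comp_isSheaf _ _ (grassmannian p k n)

theorem isSheaf_specialLattices_ulift :
    Presheaf.IsSheaf (fpqcTopology (PerfectAlg.toCommRing p k))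
      (toPresheaf (specialLattices p k n ⋙ uliftFunctor.{u + 1})) := by
  rw [isSheaf_iff_isSheaf_of_type]
  exact Presieve.isSheaf_comp_uliftFunctor _
    ((isSheaf_iff_isSheaf_of_type _ _).1 isSheaf_specialLattices)

theorem exists_iso_perfectGrassmannian :
    ∃ e : perfectGrassmannian p k n ≅ specialLattices p k n ⋙ uliftFunctor.{u + 1},
      ∀ (R : PerfectAlg p k) (g : Matrix.SpecialLinearGroup (Fin n) (WittLoc p R.obj)),
        (e.hom.app R (grassmannianMk p k n R.obj g)).down.1 =
          matrixSMul g.1 (standardLattice (WittVector p R.obj) (WittLoc p R.obj) n) := by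
  obtain ⟨e, he⟩ := exists_iso_of_W (W_cosetToGrassmannian p k n) (W_cosetToLatticePresheaf p k n)
    (isSheaf_restrict_grassmannian p k n) (isSheaf_specialLattices_ulift p k n)
  refine ⟨NatIso.ofComponents (fun R => e.app (op (op R))) fun f => e.hom.naturality f.op.op,
    fun R g => ?_⟩
  have h := ConcreteCategory.congr_hom (NatTrans.congr_app he (op (op R)))
    (ULift.up (QuotientGroup.mk g) : ULift ((cosetFunctor p k n).obj R.obj))
  exact congrArg (fun L => (ULift.down L).1) h

end Iso

end PadicGrass

end

theorem mainTheorem2 (p : ℕ) [Fact p.Prime] (k : Type u) [Field k] [CharP k p] [PerfectField k]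
    (n : ℕ) :
    Presheaf.IsSheaf (PadicGrass.fpqcTopology (PadicGrass.PerfectAlg.toCommRing p k))
      (PadicGrass.toPresheaf (PadicGrass.specialLattices p k n)) ∧
    ∃ e : PadicGrass.perfectGrassmannian p k n ≅
        PadicGrass.specialLattices p k n ⋙ uliftFunctor.{u + 1},
      ∀ (R : PadicGrass.PerfectAlg p k)
        (g : Matrix.SpecialLinearGroup (Fin n) (PadicGrass.WittLoc p R.obj)),
        (e.hom.app R (PadicGrass.grassmannianMk p k n R.obj g)).down.1 =
          PadicGrass.matrixSMul g.1
            (PadicGrass.standardLattice (WittVector p R.obj) (PadicGrass.WittLoc p R.obj) n) :=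
  ⟨PadicGrass.isSheaf_specialLattices, PadicGrass.exists_iso_perfectGrassmannian p k n⟩
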